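/- In $SO(3)$ let $A_1=\mathrm{diag}(1,-1,-1)$, $A_2=\mathrm{diag}(-1,1,-1)$, $$R_n=\begin{pmatrix}1&0&0\\0&\cos\frac{2\pi}{n}&-\sin\frac{2\pi}{n}\\0&\sin\frac{2\pi}{n}&\cos\frac{2\pi}{n}\end{pmatrix},\quad S=\begin{pmatrix}0&-1&0\\0&0&-1\\1&0&0\end{pmatrix},\quad U=\frac12\begin{pmatrix}\tau-1&-\tau&1\\\tau&1&\tau-1\\-1&\tau-1&\tau\end{pmatrix},\quad \tau=\tfrac{1+\sqrt5}{2},$$ and let $V=\langle A_1,A_2\rangle$ (Klein four group), $D_n=\langle A_2,R_n\rangle$ (dihedral group of order $2n$), $T=\langle A_1,S\rangle$, $O=\langle A_1,R_4,S\rangle$, $I=\langle A_1,S,U\rangle$ (the tetrahedral, octahedral and icosahedral groups). Identify $\mathbb{R}^4$ with the quaternions, with basis $1,i,j,k$, and $SU(2)$ with the unit quaternions, where the quaternion $x_0+x_1i+x_2j+x_3k$ corresponds to the matrix $\begin{pmatrix}x_0+\sqrt{-1}\,x_1&x_2+\sqrt{-1}\,x_3\\-x_2+\sqrt{-1}\,x_3&x_0-\sqrt{-1}\,x_1\end{pmatrix}$.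 Consider the double coverings $SU(2)\to SO(3)$, $a\mapsto(p\mapsto apa^{-1})$ (on the imaginary quaternions, with basis $i,j,k$), and $SU(2)\times SU(2)\to SO(4)$, $(a,b)\mapsto(p\mapsto apb^{-1})$. A subgroup $K\subseteq SO(3)\times SO(3)$ determines a subgroup of $SO(4)$: the image in $SO(4)$ of the inverse image of $K$ in $SU(2)\times SU(2)$. Write $G_1G_2$ for the subgroup determined by $G_1\times G_2$; write $(TT)'$, $(OO)'$, $(OO)''$ for the subgroups determined, respectively, by the inverse image in $T\times T$ of the diagonal of $T/V\times T/V$, the inverse image in $O\times O$ of the diagonal of $O/V\times O/V$, and the inverse image in $O\times O$ of the diagonal of $O/T\times O/T$. The Heisenberg group is $H=VV\subseteq SO(4)$. For a subgroup $G\subseteq SO(4)$ let $\mathbb{C}[x_0,x_1,x_2,x_3]^G_d$ be the space of $G$-invariant homogeneous polynomials of degree $d$, and let $m_d$ be its dimension. Then the following hold. (1) If $G\subseteq SO(4)$ is any subgroup containing $H$, then $\mathbb{C}[x_0,x_1,x_2,x_3]^G_d=0$ for every odd $d$. (2) The dimensions $m_d$ for even $d$ with $2\le d\le 12$ are as follows: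 $$\begin{array}{c|cccccc} G&m_2&m_4&m_6&m_8&m_{10}&m_{12}\\\hline VV&1&5&6&15&19&35\\ TV&1&1&2&5&5&13\\ TT&1&1&2&3&3&7\\ (TT)'&1&3&4&7&9&15\\ OV&1&1&1&4&4&8\\ OT&1&1&1&2&2&4\\ OO&1&1&1&2&2&3\\ (OO)'&1&2&3&5&6&9\\ (OO)''&1&1&2&3&3&5\\ IV&1&1&1&1&1&5\\ IT&1&1&1&1&1&3\\ IO&1&1&1&1&1&2\\ II&1&1&1&1&1&2 \end{array} \qquad \begin{array}{c|cccccc} G&m_2&m_4&m_6&m_8&m_{10}&m_{12}\\\hline VD_4&1&3&3&9&11&19\\ VD_6&1&3&3&6&6&14\\ VD_8&1&3&3&6&6&10\\ TD_4&1&1&1&3&3&7\\ TD_6&1&1&1&2&2&6\\ TD_8&1&1&1&2&2&4\\ OD_4&1&1&1&3&3&5\\ OD_6&1&1&1&2&2&4\\ OD_8&1&1&1&2&2&3\\ ID_4&1&1&1&1&1&3\\ ID_6&1&1&1&1&1&3\\ ID_8&1&1&1&1&1&2 \end{array}$$ (3) The dimension of $\mathbb{C}[x_0,x_1,x_2,x_3]^G_d$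 is exactly two for $(G,d)$ equal to $((OO)',4)$, $(TT,6)$, $(OO,8)$, $(IO,12)$, $(II,12)$; to $(D_nD_m,4)$ for all even $n,m\ge4$; to $(OD_n,8)$ for all even $n\ge6$; and to $(ID_n,12)$ for all even $n\ge8$. -/

import Mathlib

noncomputable section

namespace Heisenberg

/-- `SU(2)`. -/
abbrev SU2 := Matrix.specialUnitaryGroup (Fin 2) ℂ

/-- `SO(3)`. -/
abbrev SO3 := Matrix.specialOrthogonalGroup (Fin 3) ℝ

/-- `SO(4)`. -/
abbrev SO4 := Matrix.specialOrthogonalGroup (Fin 4) ℝ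

/-! ### The coverings `SU(2) → SO(3)` and `SU(2) × SU(2) → SO(4)` -/

/-- The quaternion `x₀ + x₁ i + x₂ j + x₃ k` as a complex `2 × 2` matrix. -/
def quatMat (x : Fin 4 → ℝ) : Matrix (Fin 2) (Fin 2) ℂ :=
  !![(x 0 : ℂ) + x 1 * Complex.I, (x 2 : ℂ) + x 3 * Complex.I;
     -(x 2 : ℂ) + x 3 * Complex.I, (x 0 : ℂ) - x 1 * Complex.I]

/-- The coordinates `(x₀, x₁, x₂, x₃)` of a quaternion given as a complex `2 × 2` matrix. -/
def quatCoord (P : Matrix (Fin 2) (Fin 2) ℂ) : Fin 4 → ℝ :=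
  ![(P 0 0).re, (P 0 0).im, (P 0 1).re, (P 0 1).im]

/-- The matrix of the map `p ↦ a p b*` on quaternions, in the basis `1, i, j, k`. For `b` in
`SU(2)` one has `b* = b⁻¹`. -/
def actMat (a b : Matrix (Fin 2) (Fin 2) ℂ) : Matrix (Fin 4) (Fin 4) ℝ :=
  Matrix.of fun i j => quatCoord (a * quatMat (Pi.single j 1) * star b) i

/-- The matrix of the map `p ↦ a p a*` on imaginary quaternions, in the basis `i, j, k`. -/
def rotMat (a : Matrix (Fin 2) (Fin 2) ℂ) : Matrix (Fin 3) (Fin 3) ℝ :=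
  Matrix.of fun i j => actMat a a i.succ j.succ

theorem exists_quatMat (a : SU2) :
    ∃ u : Fin 4 → ℝ, (a : Matrix (Fin 2) (Fin 2) ℂ) = quatMat u ∧
      u 0 ^ 2 + u 1 ^ 2 + u 2 ^ 2 + u 3 ^ 2 = 1 := by
  obtain ⟨A, hA⟩ := a
  obtain ⟨hu, hd⟩ := Matrix.mem_specialUnitaryGroup_iff.1 hA
  have h1 : star A * A = 1 := (Matrix.mem_unitaryGroup_iff').1 hu
  have h2 : A.adjugate = star A := by
    have : A * A.adjugate = 1 := by rw [Matrix.mul_adjugate, hd, one_smul]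
    calc A.adjugate = (star A * A) * A.adjugate := by rw [h1, one_mul]
      _ = star A := by rw [mul_assoc, this, mul_one]
  rw [Matrix.adjugate_fin_two] at h2
  have e00 := congrFun (congrFun h2 0) 0
  have e10 := congrFun (congrFun h2 0) 1
  simp [Matrix.star_apply] at e00 e10
  have e10' : A 1 0 = -star (A 0 1) := by
    have := congrArg star e10
    simp at this
    rw [← this]; simp
  rw [Matrix.det_fin_two] at hd
  refine ⟨quatCoord A, ?_, ?_⟩
  · ext i j
    fin_cases i <;> fin_cases j <;>
      simp [quatMat, quatCoord, e00, e10', Complex.ext_iff]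
  · have := congrArg Complex.re hd
    simp [e00, e10'] at this
    simp [quatCoord]
    linarith

/-- The matrix of `p ↦ u p`. -/
def leftMat (u : Fin 4 → ℝ) : Matrix (Fin 4) (Fin 4) ℝ :=
  !![u 0, -u 1, -u 2, -u 3; u 1, u 0, -u 3, u 2; u 2, u 3, u 0, -u 1; u 3, -u 2, u 1, u 0]

/-- The matrix of `p ↦ p v̄`. -/
def rightMat (v : Fin 4 → ℝ) : Matrix (Fin 4) (Fin 4) ℝ :=
  !![v 0, v 1, v 2, v 3; -v 1, v 0, -v 3, v 2; -v 2, v 3, v 0, -v 1; -v 3, -v 2, v 1, v 0]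

theorem actMat_quatMat (u v : Fin 4 → ℝ) :
    actMat (quatMat u) (quatMat v) = leftMat u * rightMat v := by
  ext i j
  fin_cases i <;> fin_cases j <;>
    simp [actMat, quatMat, quatCoord, leftMat, rightMat, Matrix.mul_apply, Fin.sum_univ_succ,
      Pi.single_apply] <;>
    ring

/-- The product of quaternions. -/
def quatMul (u v : Fin 4 → ℝ) : Fin 4 → ℝ :=
  ![u 0 * v 0 - u 1 * v 1 - u 2 * v 2 - u 3 * v 3,
    u 0 * v 1 + u 1 * v 0 + u 2 * v 3 - u 3 * v 2,
    u 0 * v 2 - u 1 * v 3 + u 2 * v 0 + u 3 * v 1,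
    u 0 * v 3 + u 1 * v 2 - u 2 * v 1 + u 3 * v 0]

theorem quatMat_mul (u v : Fin 4 → ℝ) : quatMat u * quatMat v = quatMat (quatMul u v) := by
  ext i j
  fin_cases i <;> fin_cases j <;>
    simp [quatMat, quatMul, Matrix.mul_apply, Fin.sum_univ_succ, Complex.ext_iff] <;>
    constructor <;> ring

theorem leftMat_quatMul (u v : Fin 4 → ℝ) :
    leftMat (quatMul u v) = leftMat u * leftMat v := by
  ext i j
  fin_cases i <;> fin_cases j <;>
    simp [leftMat, quatMul, Matrix.mul_apply, Fin.sum_univ_succ] <;> ring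

theorem rightMat_quatMul (u v : Fin 4 → ℝ) :
    rightMat (quatMul u v) = rightMat u * rightMat v := by
  ext i j
  fin_cases i <;> fin_cases j <;>
    simp [rightMat, quatMul, Matrix.mul_apply, Fin.sum_univ_succ] <;> ring

theorem rightMat_leftMat_comm (u v : Fin 4 → ℝ) :
    rightMat v * leftMat u = leftMat u * rightMat v := by
  ext i j
  fin_cases i <;> fin_cases j <;>
    simp [leftMat, rightMat, Matrix.mul_apply, Fin.sum_univ_succ] <;> ring

theorem actMat_one : actMat 1 1 = 1 := by
  ext i j
  fin_cases i <;> fin_cases j <;>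
    simp [actMat, quatMat, quatCoord, Pi.single_apply]

theorem actMat_mul (a b a' b' : SU2) :
    actMat ((a * a' : SU2) : Matrix (Fin 2) (Fin 2) ℂ) ((b * b' : SU2) : Matrix _ _ ℂ) =
      actMat a b * actMat a' b' := by
  obtain ⟨u, hu, -⟩ := exists_quatMat a
  obtain ⟨v, hv, -⟩ := exists_quatMat b
  obtain ⟨u', hu', -⟩ := exists_quatMat a'
  obtain ⟨v', hv', -⟩ := exists_quatMat b'
  push_cast
  rw [hu, hv, hu', hv', quatMat_mul, quatMat_mul, actMat_quatMat, actMat_quatMat,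
    actMat_quatMat, leftMat_quatMul, rightMat_quatMul]
  simp only [mul_assoc]
  rw [← mul_assoc (rightMat v), rightMat_leftMat_comm, mul_assoc]

theorem leftMat_mem (u : Fin 4 → ℝ) (hu : u 0 ^ 2 + u 1 ^ 2 + u 2 ^ 2 + u 3 ^ 2 = 1) :
    leftMat u ∈ Matrix.specialOrthogonalGroup (Fin 4) ℝ := by
  rw [Matrix.mem_specialOrthogonalGroup_iff, Matrix.mem_orthogonalGroup_iff]
  constructor
  · ext i j
    fin_cases i <;> fin_cases j <;>
      simp [leftMat, Matrix.mul_apply, Fin.sum_univ_succ] <;>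
      first | ring1 | linear_combination hu
  · simp [leftMat, Matrix.det_succ_row_zero, Fin.sum_univ_succ, Fin.succAbove]
    linear_combination (u 0 ^ 2 + u 1 ^ 2 + u 2 ^ 2 + u 3 ^ 2 + 1) * hu

theorem rightMat_mem (u : Fin 4 → ℝ) (hu : u 0 ^ 2 + u 1 ^ 2 + u 2 ^ 2 + u 3 ^ 2 = 1) :
    rightMat u ∈ Matrix.specialOrthogonalGroup (Fin 4) ℝ := by
  rw [Matrix.mem_specialOrthogonalGroup_iff, Matrix.mem_orthogonalGroup_iff]
  constructor
  · ext i j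
    fin_cases i <;> fin_cases j <;>
      simp [rightMat, Matrix.mul_apply, Fin.sum_univ_succ] <;>
      first | ring1 | linear_combination hu
  · simp [rightMat, Matrix.det_succ_row_zero, Fin.sum_univ_succ, Fin.succAbove]
    linear_combination (u 0 ^ 2 + u 1 ^ 2 + u 2 ^ 2 + u 3 ^ 2 + 1) * hu

theorem actMat_mem (a b : SU2) :
    actMat a b ∈ Matrix.specialOrthogonalGroup (Fin 4) ℝ := by
  obtain ⟨u, hu, hu1⟩ := exists_quatMat a
  obtain ⟨v, hv, hv1⟩ := exists_quatMat b
  rw [hu, hv, actMat_quatMat]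
  exact mul_mem (leftMat_mem u hu1) (rightMat_mem v hv1)

/-- The double covering `SU(2) × SU(2) → SO(4)`, `(a, b) ↦ (p ↦ a p b⁻¹)`. -/
def cover4 : SU2 × SU2 →* SO4 where
  toFun p := ⟨actMat p.1 p.2, actMat_mem p.1 p.2⟩
  map_one' := Subtype.ext actMat_one
  map_mul' p q := Subtype.ext (actMat_mul p.1 p.2 q.1 q.2)

theorem rotMat_quatMat (u : Fin 4 → ℝ) : rotMat (quatMat u) =
    !![u 0 ^ 2 + u 1 ^ 2 - u 2 ^ 2 - u 3 ^ 2, 2 * (u 1 * u 2 - u 0 * u 3),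
         2 * (u 1 * u 3 + u 0 * u 2);
       2 * (u 1 * u 2 + u 0 * u 3), u 0 ^ 2 - u 1 ^ 2 + u 2 ^ 2 - u 3 ^ 2,
         2 * (u 2 * u 3 - u 0 * u 1);
       2 * (u 1 * u 3 - u 0 * u 2), 2 * (u 2 * u 3 + u 0 * u 1),
         u 0 ^ 2 - u 1 ^ 2 - u 2 ^ 2 + u 3 ^ 2] := by
  ext i j
  rw [rotMat, actMat_quatMat]
  fin_cases i <;> fin_cases j <;>
    simp [leftMat, rightMat, Matrix.mul_apply, Fin.sum_univ_succ] <;> ring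

theorem rotMat_one : rotMat 1 = 1 := by
  ext i j
  rw [rotMat, actMat_one]
  simp [Matrix.one_apply]

theorem rotMat_mul (a b : SU2) :
    rotMat ((a * b : SU2) : Matrix (Fin 2) (Fin 2) ℂ) = rotMat a * rotMat b := by
  obtain ⟨u, hu, -⟩ := exists_quatMat a
  obtain ⟨v, hv, -⟩ := exists_quatMat b
  push_cast
  rw [hu, hv, quatMat_mul, rotMat_quatMat, rotMat_quatMat, rotMat_quatMat]
  ext i j
  fin_cases i <;> fin_cases j <;>
    simp [quatMul, Matrix.mul_apply, Fin.sum_univ_succ] <;> ring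

theorem rotMat_mem (a : SU2) : rotMat a ∈ Matrix.specialOrthogonalGroup (Fin 3) ℝ := by
  obtain ⟨u, hu, hu1⟩ := exists_quatMat a
  rw [hu, rotMat_quatMat, Matrix.mem_specialOrthogonalGroup_iff, Matrix.mem_orthogonalGroup_iff]
  constructor
  · ext i j
    fin_cases i <;> fin_cases j <;>
      simp [Matrix.mul_apply, Fin.sum_univ_succ] <;>
      first
      | ring1
      | linear_combination (u 0 ^ 2 + u 1 ^ 2 + u 2 ^ 2 + u 3 ^ 2 + 1) * hu1
  · rw [Matrix.det_fin_three]
    simp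
    linear_combination ((u 0 ^ 2 + u 1 ^ 2 + u 2 ^ 2 + u 3 ^ 2) ^ 2 +
      (u 0 ^ 2 + u 1 ^ 2 + u 2 ^ 2 + u 3 ^ 2) + 1) * hu1

/-- The universal covering `SU(2) → SO(3)`, `a ↦ (p ↦ a p a⁻¹)` on imaginary quaternions. -/
def cover3 : SU2 →* SO3 where
  toFun a := ⟨rotMat a, rotMat_mem a⟩
  map_one' := Subtype.ext rotMat_one
  map_mul' a b := Subtype.ext (rotMat_mul a b)

/-! ### Ternary groups -/

/-- The half-turn `A₁ = diag(1, -1, -1)`. -/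
def A₁ : SO3 := ⟨!![1, 0, 0; 0, -1, 0; 0, 0, -1], by
  rw [Matrix.mem_specialOrthogonalGroup_iff, Matrix.mem_orthogonalGroup_iff]
  constructor
  · ext i j
    fin_cases i <;> fin_cases j <;> simp [Matrix.mul_apply, Fin.sum_univ_succ]
  · simp [Matrix.det_fin_three]⟩

/-- The half-turn `A₂ = diag(-1, 1, -1)`. -/
def A₂ : SO3 := ⟨!![-1, 0, 0; 0, 1, 0; 0, 0, -1], by
  rw [Matrix.mem_specialOrthogonalGroup_iff, Matrix.mem_orthogonalGroup_iff]
  constructor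
  · ext i j
    fin_cases i <;> fin_cases j <;> simp [Matrix.mul_apply, Fin.sum_univ_succ]
  · simp [Matrix.det_fin_three]⟩

/-- The rotation `Rₙ` by `2π/n` about the first axis. -/
def R (n : ℕ) : SO3 :=
  ⟨!![1, 0, 0;
      0, Real.cos (2 * Real.pi / n), -Real.sin (2 * Real.pi / n);
      0, Real.sin (2 * Real.pi / n), Real.cos (2 * Real.pi / n)], by
  rw [Matrix.mem_specialOrthogonalGroup_iff, Matrix.mem_orthogonalGroup_iff]
  have h := Real.sin_sq_add_cos_sq (2 * Real.pi / n)
  constructor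
  · ext i j
    fin_cases i <;> fin_cases j <;> simp [Matrix.mul_apply, Fin.sum_univ_succ] <;>
      first | ring1 | linear_combination h
  · simp [Matrix.det_fin_three]
    linear_combination h⟩

/-- The rotation `S` of order three. -/
def S : SO3 := ⟨!![0, -1, 0; 0, 0, -1; 1, 0, 0], by
  rw [Matrix.mem_specialOrthogonalGroup_iff, Matrix.mem_orthogonalGroup_iff]
  constructor
  · ext i j
    fin_cases i <;> fin_cases j <;> simp [Matrix.mul_apply, Fin.sum_univ_succ]
  · simp [Matrix.det_fin_three]⟩

/-- The rotation `U` of order five; here `τ = (1 + √5) / 2`. -/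
def U : SO3 :=
  ⟨(1 / 2 : ℝ) • !![Real.goldenRatio - 1, -Real.goldenRatio, 1;
                    Real.goldenRatio, 1, Real.goldenRatio - 1;
                    -1, Real.goldenRatio - 1, Real.goldenRatio], by
  rw [Matrix.mem_specialOrthogonalGroup_iff, Matrix.mem_orthogonalGroup_iff]
  have h := Real.goldenRatio_sq
  generalize Real.goldenRatio = t at h ⊢
  constructor
  · ext i j
    fin_cases i <;> fin_cases j <;> simp [Matrix.mul_apply, Fin.sum_univ_succ] <;>
      first
      | ring1
      | linear_combination (1 / 2) * h
      | linear_combination (1 / 4) * h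
      | linear_combination (-1 / 4) * h
  · simp [Matrix.det_fin_three]
    linear_combination (3 / 4) * h⟩

/-- The Klein four group. -/
def V : Subgroup SO3 := Subgroup.closure {A₁, A₂}

/-- The dihedral group of order `2n`. -/
def D (n : ℕ) : Subgroup SO3 := Subgroup.closure {A₂, R n}

/-- The tetrahedral group. -/
def T : Subgroup SO3 := Subgroup.closure {A₁, S}

/-- The octahedral group. -/
def O : Subgroup SO3 := Subgroup.closure {A₁, R 4, S}

/-- The icosahedral group. -/
def I : Subgroup SO3 := Subgroup.closure {A₁, S, U}

/-! ### Quaternary groups -/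

/-- The subgroup of `SO(4)` determined by a subgroup `K` of `SO(3) × SO(3)`: the image under
`SU(2) × SU(2) → SO(4)` of the inverse image of `K` under `SU(2) × SU(2) → SO(3) × SO(3)`. -/
def quaternary (K : Subgroup (SO3 × SO3)) : Subgroup SO4 :=
  (K.comap (cover3.prodMap cover3)).map cover4

/-- The group `G₁G₂ ⊆ SO(4)`. -/
def bi (G₁ G₂ : Subgroup SO3) : Subgroup SO4 := quaternary (G₁.prod G₂)

/-- The Heisenberg group `H = VV ⊆ SO(4)`. -/
def H : Subgroup SO4 := bi V V

/-- The diagonal of `G × G`. -/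
def diag (G : Subgroup SO3) : Subgroup (SO3 × SO3) :=
  G.map ((MonoidHom.id SO3).prod (MonoidHom.id SO3))

/-- `(TT)'`, from the inverse image in `T × T` of the diagonal of `T/V × T/V`, which is the
subgroup generated by `V × V` and the diagonal of `T × T` because `V` is normal in `T`. -/
def TT' : Subgroup SO4 := quaternary (V.prod V ⊔ diag T)

/-- `(OO)'`, from the inverse image in `O × O` of the diagonal of `O/V × O/V`, which is the
subgroup generated by `V × V` and the diagonal of `O × O` because `V` is normal in `O`. -/
def OO' : Subgroup SO4 := quaternary (V.prod V ⊔ diag O)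

/-- `(OO)''`, from the inverse image in `O × O` of the diagonal of `O/T × O/T`, which is the
subgroup generated by `T × T` and the diagonal of `O × O` because `T` is normal in `O`. -/
def OO'' : Subgroup SO4 := quaternary (T.prod T ⊔ diag O)

/-! ### Invariant polynomials -/

/-- The substitution `xᵢ ↦ ∑ⱼ gᵢⱼ xⱼ`, that is `f ↦ (x ↦ f (g x))`, on `ℂ[x₀, x₁, x₂, x₃]`. -/
def substHom (g : SO4) : MvPolynomial (Fin 4) ℂ →ₐ[ℂ] MvPolynomial (Fin 4) ℂ :=
  MvPolynomial.aeval fun i =>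
    ∑ j, MvPolynomial.C (((g : Matrix (Fin 4) (Fin 4) ℝ) i j : ℝ) : ℂ) * MvPolynomial.X j

/-- `ℂ[x₀, x₁, x₂, x₃]ᴳ_d`, the space of `G`-invariant polynomials homogeneous of degree `d`. -/
def invariantForms (G : Subgroup SO4) (d : ℕ) : Submodule ℂ (MvPolynomial (Fin 4) ℂ) where
  carrier := {f | f.IsHomogeneous d ∧ ∀ g ∈ G, substHom g f = f}
  add_mem' := fun hf hg => ⟨hf.1.add hg.1, fun g hG => by rw [map_add, hf.2 g hG, hg.2 g hG]⟩
  zero_mem' := ⟨MvPolynomial.isHomogeneous_zero _ _ _, fun g _ => map_zero _⟩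
  smul_mem' := fun c f hf =>
    ⟨(MvPolynomial.homogeneousSubmodule (Fin 4) ℂ d).smul_mem c hf.1,
      fun g hG => by rw [map_smul, hf.2 g hG]⟩

/-- `m_d = dim ℂ[x₀, x₁, x₂, x₃]ᴳ_d`. -/
def m (G : Subgroup SO4) (d : ℕ) : ℕ := Module.finrank ℂ (invariantForms G d)

/-- The row `[m₂, m₄, m₆, m₈, m₁₀, m₁₂]` of dimensions for `G`. -/
def dims (G : Subgroup SO4) : List ℕ := [m G 2, m G 4, m G 6, m G 8, m G 10, m G 12]

end Heisenberg

end

/-!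
The forms `ℂ[x₀, …, x₃]` are the polynomial functions on `ℂ² ⊗ ℂ²`, the space of complex `2 × 2`
matrices, on which `(a, b) ∈ SU(2) × SU(2)` acts by `p ↦ a p bᵀ` after a fixed change of
coordinates (`twistMat`). The determinant `q` is invariant, and restricting a form of degree `k` to
the cone `q = 0` of matrices of rank at most one gives a form of bidegree `(k, k)` in two pairs of
variables. Hence a form of degree `d + 2` is uniquely `q f + matForm (d + 2) N`, where `f` has
degree `d` and `N` is a matrix of coefficients; the sum is direct because `N` is recovered on the
cone, and it is everything by a count of dimensions (`map_stepMap_homogeneous`). The splitting is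
equivariant, with `N ↦ Symᵏ(a)ᵀ N Symᵏ(b)` on the second summand (`substHom_matForm`), so
`m_{d + 2} = m_d + dim (invariant N)` (`m_add_two`). For a product `G₁ × G₂` the invariant matrices
are the tensor product of the spaces of binary invariants, whose dimensions multiply
(`finrank_invMat_prod`). It remains to find the binary invariants of even degree `2 l`, `l ≤ 6`.

* For `V` and `D n` the torus generator is diagonal on monomials and the half-turn `A₂` reverses
  them, so the dimension counts orbits of weights (`invVec_dihedral`).
* Three binary quadratics `Q₁, Q₂, Q₃` with `∑ Qⱼ² = 0` transform like the coordinates of `ℝ³`.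
  With `ω` a primitive cube root of unity put `u = Q₁² + ω Q₂² + ω² Q₃²`,
  `ū = Q₁² + ω² Q₂² + ω Q₃²` and `t = Q₁ Q₂ Q₃`. For `l = 3 c + 2 j` with `c ≤ 1` the forms
  `tᶜ uⁱ ūʲ⁻ⁱ` are a basis of the invariants of `V` (`kleinBasis`). The rotation `S` is diagonal in
  it, and `R₄` exchanges `u` and `ū` and changes the sign of `t`. This gives the dimensions for `T`
  and `O`, and also for `(TT)'`, `(OO)'`, `(OO)''`, where the same generators act on the
  coordinates of `∑ Cᵢⱼ eᵢ ⊗ eⱼ`.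
* The invariants of `I` lie among those of `T`, which are spanned by `1`, `t`, `u ū` in degrees
  `l = 0, 3, 4` and are a plane for `l = 6`. The rotation `U` fixes none of `t`, `u ū` and `t²`,
  but it fixes the product of the linear forms of the six fivefold axes, of degree `l = 6`
  (`finrank_invVec_I`).

In odd degree there are no invariants because `H` contains `-1`.
-/

noncomputable section

namespace Heisenberg

section

open Polynomial

/-! ### Binary forms and symmetric powers -/

/-- The binary form `∑ vᵢ sⁱ tᵏ⁻ⁱ` with coefficient vector `v`, as a function of `(s, t)`. -/
def binForm {k : ℕ} (v : Fin (k + 1) → ℂ) (s t : ℂ) : ℂ :=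
  ∑ i, v i * (s ^ (i : ℕ) * t ^ (k - i))

theorem binForm_injective {k : ℕ} {v w : Fin (k + 1) → ℂ}
    (h : ∀ s t, binForm v s t = binForm w s t) : v = w := by
  have key : ∀ v : Fin (k + 1) → ℂ, ∀ j : Fin (k + 1),
      (∑ i, Polynomial.C (v i) * Polynomial.X ^ (i : ℕ)).coeff j = v j := by
    intro v j
    simp [Polynomial.coeff_X_pow, Fin.val_inj]
  have hp : (∑ i, Polynomial.C (v i) * Polynomial.X ^ (i : ℕ)) =
      ∑ i, Polynomial.C (w i) * Polynomial.X ^ (i : ℕ) := by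
    apply Polynomial.funext
    intro s
    simpa [binForm, Polynomial.eval_finsetSum] using h s 1
  funext j
  rw [← key v j, hp, key]

/-- The `k`-th symmetric power of a `2 × 2` matrix `m`: row `a` consists of the coefficients of
`(m₀₀ s + m₀₁ t)ᵃ (m₁₀ s + m₁₁ t)ᵏ⁻ᵃ`. -/
def symPow {A : Type*} [CommRing A] (k : ℕ) (m : Matrix (Fin 2) (Fin 2) A) :
    Matrix (Fin (k + 1)) (Fin (k + 1)) A :=
  Matrix.of fun a b =>
    ((C (m 0 0) * X + C (m 0 1)) ^ (a : ℕ) * (C (m 1 0) * X + C (m 1 1)) ^ (k - a)).coeff b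

theorem symPow_map {A B : Type*} [CommRing A] [CommRing B] (φ : A →+* B) (k : ℕ)
    (m : Matrix (Fin 2) (Fin 2) A) (a b : Fin (k + 1)) :
    φ (symPow k m a b) = symPow k (m.map φ) a b := by
  simp only [symPow, Matrix.of_apply, Matrix.map_apply]
  rw [← Polynomial.coeff_map]
  simp

theorem sum_coeff_eq_eval_homogenize (p : ℂ[X]) (k : ℕ) (s t : ℂ) :
    ∑ b : Fin (k + 1), p.coeff b * (s ^ (b : ℕ) * t ^ (k - b)) =
      MvPolynomial.eval ![s, t] (p.homogenize k) := by
  rw [Polynomial.homogenize, map_sum, Finset.Nat.sum_antidiagonal_eq_sum_range_succ_mk,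
    Finset.sum_range]
  refine Finset.sum_congr rfl fun b _ => ?_
  rw [MvPolynomial.eval_monomial]
  congr 1
  rw [Finsupp.prod_fintype _ _ (by simp)]
  simp [Fin.prod_univ_two]

theorem eval_homogenize_linear_pow (α β s t : ℂ) (k : ℕ) :
    MvPolynomial.eval ![s, t] (((C α * X + C β) ^ k).homogenize k) = (α * s + β * t) ^ k := by
  have hdeg : (C α * X + C β : ℂ[X]).natDegree ≤ 1 := by compute_degree
  have h1 : MvPolynomial.eval ![s, t] ((C α * X + C β).homogenize 1) = α * s + β * t := by
    simp [Polynomial.homogenize_add, Polynomial.homogenize_C_mul]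
  induction k with
  | zero => simp
  | succ n ih =>
    rw [pow_succ, Polynomial.homogenize_mul _ _ _ hdeg, map_mul, ih, h1, pow_succ]
    exact Polynomial.natDegree_pow_le_of_le n hdeg |>.trans (by simp)

theorem eval_homogenize_linear_pow_mul (α β γ δ s t : ℂ) (i j : ℕ) :
    MvPolynomial.eval ![s, t]
      (((C α * X + C β) ^ i * (C γ * X + C δ) ^ j).homogenize (i + j)) =
      (α * s + β * t) ^ i * (γ * s + δ * t) ^ j := by
  have hdeg : ∀ (α β : ℂ) (n : ℕ), ((C α * X + C β : ℂ[X]) ^ n).natDegree ≤ n := fun α β n =>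
    (Polynomial.natDegree_pow_le_of_le n (by compute_degree : (C α * X + C β).natDegree ≤ 1)).trans
      (by simp)
  rw [Polynomial.homogenize_mul _ _ (hdeg _ _ _) (hdeg _ _ _), map_mul,
    eval_homogenize_linear_pow, eval_homogenize_linear_pow]

theorem binForm_symPow_row {k : ℕ} (m : Matrix (Fin 2) (Fin 2) ℂ) (a : Fin (k + 1)) (s t : ℂ) :
    binForm (symPow k m a) s t =
      (m 0 0 * s + m 0 1 * t) ^ (a : ℕ) * (m 1 0 * s + m 1 1 * t) ^ (k - a) := by
  have h := eval_homogenize_linear_pow_mul (m 0 0) (m 0 1) (m 1 0) (m 1 1) s t a (k - a)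
  rw [show (a : ℕ) + (k - a) = k by omega, ← sum_coeff_eq_eval_homogenize] at h
  exact h

/-- The symmetric power acts on coefficient vectors by linear substitution in the form. -/
theorem binForm_vecMul_symPow {k : ℕ} (v : Fin (k + 1) → ℂ) (m : Matrix (Fin 2) (Fin 2) ℂ)
    (s t : ℂ) :
    binForm (Matrix.vecMul v (symPow k m)) s t =
      binForm v (m 0 0 * s + m 0 1 * t) (m 1 0 * s + m 1 1 * t) := by
  have h : ∀ a, v a * ((m 0 0 * s + m 0 1 * t) ^ (a : ℕ) * (m 1 0 * s + m 1 1 * t) ^ (k - a)) =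
      v a * binForm (symPow k m a) s t := fun a => by rw [binForm_symPow_row]
  conv_rhs => rw [binForm]
  simp only [h]
  simp only [binForm, Matrix.vecMul, dotProduct, Finset.sum_mul, Finset.mul_sum]
  rw [Finset.sum_comm]
  simp only [mul_assoc]

theorem symPow_mul {k : ℕ} (m n : Matrix (Fin 2) (Fin 2) ℂ) :
    symPow k (m * n) = symPow k m * symPow k n := by
  ext a b
  refine congrFun (binForm_injective (v := symPow k (m * n) a) (w := (symPow k m * symPow k n) a)
    fun s t => ?_) b
  have : (symPow k m * symPow k n) a = Matrix.vecMul (symPow k m a) (symPow k n) := by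
    funext b; rfl
  rw [this, binForm_vecMul_symPow, binForm_symPow_row, binForm_symPow_row]
  simp only [Matrix.mul_apply, Fin.sum_univ_two]
  ring

theorem symPow_one {k : ℕ} : symPow k (1 : Matrix (Fin 2) (Fin 2) ℂ) = 1 := by
  ext a b
  refine congrFun (binForm_injective (v := symPow k 1 a)
    (w := (1 : Matrix (Fin (k + 1)) (Fin (k + 1)) ℂ) a) fun s t => ?_) b
  rw [binForm_symPow_row]
  simp [binForm, Matrix.one_apply]

/-- A doubly indexed coefficient array is determined by its bihomogeneous form. -/
theorem matrix_ext_of_binForm {k : ℕ} {M N : Matrix (Fin (k + 1)) (Fin (k + 1)) ℂ}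
    (h : ∀ x y s t, (∑ a : Fin (k + 1), binForm (M a) s t * (x ^ (a : ℕ) * y ^ (k - a))) =
      ∑ a : Fin (k + 1), binForm (N a) s t * (x ^ (a : ℕ) * y ^ (k - a))) : M = N := by
  ext a b
  refine congrFun (binForm_injective (v := M a) (w := N a) fun s t => ?_) b
  exact congrFun (binForm_injective (v := fun a => binForm (M a) s t)
    (w := fun a => binForm (N a) s t) fun x y => h x y s t) a

theorem sum_binomial_mul (k : ℕ) (x y : ℂ) :
    ∑ a : Fin (k + 1), (k.choose a : ℂ) * (x ^ (a : ℕ) * y ^ (k - a)) = (x + y) ^ k := by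
  rw [add_pow, Finset.sum_range]
  exact Finset.sum_congr rfl fun i _ => by ring

/-- Up to the binomial weights, the symmetric power of the transpose is the transpose of the
symmetric power: both sides are coefficients of `(s' (m₀₀ s + m₀₁ t) + t' (m₁₀ s + m₁₁ t))ᵏ`. -/
theorem choose_mul_symPow_transpose {k : ℕ} (m : Matrix (Fin 2) (Fin 2) ℂ) (a b : Fin (k + 1)) :
    (k.choose a : ℂ) * symPow k m a b = (k.choose b : ℂ) * symPow k m.transpose b a := by
  have key : ∀ (m : Matrix (Fin 2) (Fin 2) ℂ) (x y s t : ℂ),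
      ∑ a : Fin (k + 1), (∑ b : Fin (k + 1), ((k.choose a : ℂ) * symPow k m a b) *
        (s ^ (b : ℕ) * t ^ (k - b))) * (x ^ (a : ℕ) * y ^ (k - a)) =
      (x * (m 0 0 * s + m 0 1 * t) + y * (m 1 0 * s + m 1 1 * t)) ^ k := by
    intro m x y s t
    rw [← sum_binomial_mul]
    refine Finset.sum_congr rfl fun a _ => ?_
    have := binForm_symPow_row m a s t
    rw [mul_pow, mul_pow]
    calc _ = (k.choose a : ℂ) * binForm (symPow k m a) s t * (x ^ (a : ℕ) * y ^ (k - a)) := by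
          simp only [binForm, Finset.mul_sum, mul_assoc]
      _ = _ := by rw [this]; ring
  have := matrix_ext_of_binForm
    (M := Matrix.of fun a b : Fin (k + 1) => (k.choose a : ℂ) * symPow k m a b)
    (N := Matrix.of fun a b => (k.choose b : ℂ) * symPow k m.transpose b a) ?_
  · exact congrFun (congrFun this a) b
  intro x y s t
  simp only [binForm, Matrix.of_apply]
  rw [key]
  have h2 := key m.transpose s t x y
  simp only [Finset.sum_mul] at h2 ⊢
  rw [Finset.sum_comm] at h2
  rw [show (∑ a : Fin (k + 1), ∑ b : Fin (k + 1), (k.choose b : ℂ) * symPow k m.transpose b a *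
      (s ^ (b : ℕ) * t ^ (k - b)) * (x ^ (a : ℕ) * y ^ (k - a))) = _ from
    (Finset.sum_congr rfl fun a _ => Finset.sum_congr rfl fun b _ => by ring).trans h2]
  simp only [Matrix.transpose_apply]
  ring

/-! ### Quaternary forms -/

/-- The quaternion with coordinates `x` in a `ℂ`-algebra, as a `2 × 2` matrix multiplied on the
right by `(0 1; -1 0)`. The multiplication turns `p ↦ a p b⁻¹` into `p ↦ a p bᵀ`. -/
def twistMat {A : Type*} [CommRing A] [Algebra ℂ A] (x : Fin 4 → A) : Matrix (Fin 2) (Fin 2) A :=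
  !![-x 2 - algebraMap ℂ A Complex.I * x 3, x 0 + algebraMap ℂ A Complex.I * x 1;
     -x 0 + algebraMap ℂ A Complex.I * x 1, -x 2 + algebraMap ℂ A Complex.I * x 3]

theorem twistMat_mulVec (u v : Fin 4 → ℝ) (x : Fin 4 → ℂ) :
    twistMat (fun i => ∑ j, (((leftMat u * rightMat v) i j : ℝ) : ℂ) * x j) =
      quatMat u * twistMat x * (quatMat v).transpose := by
  have hI := Complex.I_sq
  ext i j
  fin_cases i <;> fin_cases j <;>
    simp [twistMat, quatMat, leftMat, rightMat, Matrix.mul_apply, Fin.sum_univ_succ] <;>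
    grind

/-- Every matrix of rank at most one is a twisted quaternion. -/
theorem exists_twistMat_eq (z w : Fin 2 → ℂ) :
    ∃ x : Fin 4 → ℂ, twistMat x = Matrix.of fun i j => z i * w j := by
  have hI := Complex.I_sq
  refine ⟨![(z 0 * w 1 - z 1 * w 0) / 2, -Complex.I * (z 0 * w 1 + z 1 * w 0) / 2,
    -(z 0 * w 0 + z 1 * w 1) / 2, -Complex.I * (z 1 * w 1 - z 0 * w 0) / 2], ?_⟩
  ext i j
  fin_cases i <;> fin_cases j <;> simp [twistMat] <;> grind

/-- The norm form `x₀² + x₁² + x₂² + x₃²`. -/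
def normForm : MvPolynomial (Fin 4) ℂ := ∑ i, MvPolynomial.X i ^ 2

theorem normForm_isHomogeneous : normForm.IsHomogeneous 2 :=
  MvPolynomial.IsHomogeneous.sum _ _ _ fun i _ => MvPolynomial.isHomogeneous_X_pow i 2

theorem normForm_ne_zero : normForm ≠ 0 := by
  intro h
  have := congrArg (MvPolynomial.eval fun _ => (1 : ℂ)) h
  simp [normForm] at this

theorem eval_normForm (x : Fin 4 → ℂ) :
    MvPolynomial.eval x normForm = (twistMat x).det := by
  have hI := Complex.I_sq
  simp [normForm, twistMat, Matrix.det_fin_two, Fin.sum_univ_succ]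
  grind

/-- The quaternary form of degree `k` attached to a matrix `N`, obtained by contracting `N` with
the `k`-th symmetric power of the generic quaternion. The binomial weights make it equivariant,
see `substHom_matForm`. -/
def matForm (k : ℕ) :
    Matrix (Fin (k + 1)) (Fin (k + 1)) ℂ →ₗ[ℂ] MvPolynomial (Fin 4) ℂ where
  toFun N := ∑ a, ∑ b, MvPolynomial.C (N a b / (k.choose b : ℂ)) *
    symPow k (twistMat MvPolynomial.X) a b
  map_add' M N := by
    simp only [Matrix.add_apply, add_div, map_add, add_mul, Finset.sum_add_distrib]
  map_smul' c N := by
    simp only [Matrix.smul_apply, smul_eq_mul, mul_div_assoc, map_mul, mul_assoc, Finset.mul_sum,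
      RingHom.id_apply, MvPolynomial.smul_eq_C_mul]

theorem twistMat_X_map_eval (x : Fin 4 → ℂ) :
    (twistMat (MvPolynomial.X : Fin 4 → MvPolynomial (Fin 4) ℂ)).map (MvPolynomial.eval x) =
      twistMat x := by
  ext i j
  fin_cases i <;> fin_cases j <;> simp [twistMat, MvPolynomial.algebraMap_eq]

theorem eval_matForm {k : ℕ} (N : Matrix (Fin (k + 1)) (Fin (k + 1)) ℂ) (x : Fin 4 → ℂ) :
    MvPolynomial.eval x (matForm k N) =
      ∑ a, ∑ b, N a b / (k.choose b : ℂ) * symPow k (twistMat x) a b := by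
  simp [matForm, symPow_map, twistMat_X_map_eval]

theorem isHomogeneous_coeff_mul {σ : Type*} {P Q : (MvPolynomial σ ℂ)[X]} {i j : ℕ}
    (hP : ∀ n, (P.coeff n).IsHomogeneous i) (hQ : ∀ n, (Q.coeff n).IsHomogeneous j) (n : ℕ) :
    ((P * Q).coeff n).IsHomogeneous (i + j) := by
  rw [Polynomial.coeff_mul]
  exact MvPolynomial.IsHomogeneous.sum _ _ _ fun x _ => (hP _).mul (hQ _)

theorem isHomogeneous_coeff_pow {σ : Type*} {P : (MvPolynomial σ ℂ)[X]}
    (hP : ∀ n, (P.coeff n).IsHomogeneous 1) (i n : ℕ) : ((P ^ i).coeff n).IsHomogeneous i := by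
  induction i generalizing n with
  | zero =>
    rw [pow_zero, Polynomial.coeff_one]
    split_ifs
    · exact MvPolynomial.isHomogeneous_one _ _
    · exact MvPolynomial.isHomogeneous_zero _ _ _
  | succ i ih => rw [pow_succ]; exact isHomogeneous_coeff_mul ih hP n

theorem twistMat_X_isHomogeneous (i j : Fin 2) :
    (twistMat (MvPolynomial.X : Fin 4 → MvPolynomial (Fin 4) ℂ) i j).IsHomogeneous 1 := by
  have hX := MvPolynomial.isHomogeneous_X (R := ℂ) (σ := Fin 4)
  have hC : ∀ k : Fin 4, (algebraMap ℂ (MvPolynomial (Fin 4) ℂ) Complex.I *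
      MvPolynomial.X k).IsHomogeneous 1 := fun k => by
    simpa [MvPolynomial.algebraMap_eq] using (MvPolynomial.isHomogeneous_C_mul_X Complex.I k)
  fin_cases i <;> fin_cases j
  · exact (hX 2).neg.sub (hC 3)
  · exact (hX 0).add (hC 1)
  · exact (hX 0).neg.add (hC 1)
  · exact (hX 2).neg.add (hC 3)

theorem matForm_isHomogeneous {k : ℕ} (N : Matrix (Fin (k + 1)) (Fin (k + 1)) ℂ) :
    (matForm k N).IsHomogeneous k := by
  have hlin : ∀ i n, ((C (twistMat (MvPolynomial.X : Fin 4 → MvPolynomial (Fin 4) ℂ) i 0) * X +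
      C (twistMat (MvPolynomial.X : Fin 4 → MvPolynomial (Fin 4) ℂ) i 1)).coeff n).IsHomogeneous
        1 := by
    intro i n
    rw [Polynomial.coeff_add, Polynomial.coeff_C_mul, Polynomial.coeff_X, Polynomial.coeff_C]
    refine MvPolynomial.IsHomogeneous.add ?_ ?_
    · split_ifs
      · rw [mul_one]; exact twistMat_X_isHomogeneous i 0
      · rw [mul_zero]; exact MvPolynomial.isHomogeneous_zero _ _ _
    · split_ifs
      · exact twistMat_X_isHomogeneous i 1
      · exact MvPolynomial.isHomogeneous_zero _ _ _
  refine MvPolynomial.IsHomogeneous.sum _ _ _ fun a _ => MvPolynomial.IsHomogeneous.sum _ _ _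
    fun b _ => MvPolynomial.IsHomogeneous.C_mul ?_ _
  have := isHomogeneous_coeff_mul (isHomogeneous_coeff_pow (hlin 0) a)
    (isHomogeneous_coeff_pow (hlin 1) (k - a)) b
  rwa [show (a : ℕ) + (k - a) = k by omega] at this

theorem eval_substHom (g : SO4) (f : MvPolynomial (Fin 4) ℂ) (x : Fin 4 → ℂ) :
    MvPolynomial.eval x (substHom g f) = MvPolynomial.eval
      (fun i => ∑ j, (((g : Matrix (Fin 4) (Fin 4) ℝ) i j : ℝ) : ℂ) * x j) f := by
  have h : (MvPolynomial.aeval x).comp (substHom g) = MvPolynomial.aeval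
      (fun i => ∑ j, (((g : Matrix (Fin 4) (Fin 4) ℝ) i j : ℝ) : ℂ) * x j) :=
    MvPolynomial.algHom_ext fun i => by simp [substHom]
  exact AlgHom.congr_fun h f

theorem twistMat_cover4 (a b : SU2) (x : Fin 4 → ℂ) :
    twistMat (fun i => ∑ j, (((cover4 (a, b) : Matrix (Fin 4) (Fin 4) ℝ) i j : ℝ) : ℂ) * x j) =
      (a : Matrix (Fin 2) (Fin 2) ℂ) * twistMat x * (b : Matrix (Fin 2) (Fin 2) ℂ).transpose := by
  obtain ⟨u, hu, -⟩ := exists_quatMat a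
  obtain ⟨v, hv, -⟩ := exists_quatMat b
  have : (cover4 (a, b) : Matrix (Fin 4) (Fin 4) ℝ) = leftMat u * rightMat v := by
    rw [← actMat_quatMat, ← hu, ← hv]; rfl
  rw [this, hu, hv, twistMat_mulVec]

theorem substHom_normForm (a b : SU2) : substHom (cover4 (a, b)) normForm = normForm := by
  apply MvPolynomial.funext
  intro x
  have ha := (Matrix.mem_specialUnitaryGroup_iff.1 a.2).2
  have hb := (Matrix.mem_specialUnitaryGroup_iff.1 b.2).2
  rw [eval_substHom, eval_normForm, twistMat_cover4, Matrix.det_mul, Matrix.det_mul,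
    Matrix.det_transpose, ha, hb, ← eval_normForm, one_mul, mul_one]

theorem choose_ne_zero {k : ℕ} (b : Fin (k + 1)) : (k.choose b : ℂ) ≠ 0 := by
  have := Nat.choose_pos (n := k) (k := b) (by omega)
  exact_mod_cast this.ne'

theorem substHom_matForm {k : ℕ} (a b : SU2) (N : Matrix (Fin (k + 1)) (Fin (k + 1)) ℂ) :
    substHom (cover4 (a, b)) (matForm k N) =
      matForm k ((symPow k (a : Matrix (Fin 2) (Fin 2) ℂ)).transpose * N *
        symPow k (b : Matrix (Fin 2) (Fin 2) ℂ)) := by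
  apply MvPolynomial.funext
  intro x
  rw [eval_substHom, eval_matForm, eval_matForm, twistMat_cover4, symPow_mul, symPow_mul]
  generalize symPow k (twistMat x) = M
  generalize symPow k (a : Matrix (Fin 2) (Fin 2) ℂ) = P
  have hB : ∀ i j, symPow k (b : Matrix (Fin 2) (Fin 2) ℂ).transpose i j =
      (k.choose j : ℂ) / (k.choose i : ℂ) * symPow k (b : Matrix (Fin 2) (Fin 2) ℂ) j i := by
    intro i j
    have := choose_mul_symPow_transpose (k := k) (b : Matrix (Fin 2) (Fin 2) ℂ) j i
    have hi := choose_ne_zero i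
    field_simp
    linear_combination -this
  -- Both sides are traces of the same product, once the transpose is traded for the weights.
  set w : Fin (k + 1) → ℂ := fun i => (k.choose i : ℂ) with hw
  have h1 : symPow k (b : Matrix (Fin 2) (Fin 2) ℂ).transpose =
      Matrix.diagonal w⁻¹ * (symPow k (b : Matrix (Fin 2) (Fin 2) ℂ)).transpose *
        Matrix.diagonal w := by
    ext i j
    rw [hB, Matrix.mul_diagonal, Matrix.diagonal_mul, Matrix.transpose_apply]
    simp only [hw, Pi.inv_apply]
    ring
  have h2 : ∀ X Y : Matrix (Fin (k + 1)) (Fin (k + 1)) ℂ,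
      ∑ i, ∑ j, X i j / (k.choose j : ℂ) * Y i j =
        (X * Matrix.diagonal w⁻¹ * Y.transpose).trace := by
    intro X Y
    simp [Matrix.trace, Matrix.mul_apply, hw, div_eq_mul_inv, Matrix.diagonal]
  have h3 : Matrix.diagonal w⁻¹ * Matrix.diagonal w = 1 := by
    rw [Matrix.diagonal_mul_diagonal, ← Matrix.diagonal_one]
    congr 1
    funext i
    exact inv_mul_cancel₀ (choose_ne_zero i)
  rw [h2, h2, h1]
  simp only [Matrix.transpose_mul, Matrix.diagonal_transpose, Matrix.transpose_transpose]
  simp only [mul_assoc]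
  rw [← mul_assoc (Matrix.diagonal w⁻¹) (Matrix.diagonal w), h3, one_mul,
    Matrix.trace_mul_comm P.transpose]
  simp only [mul_assoc]

/-- On matrices of rank one, `matForm k N` is the bihomogeneous form with coefficients `N`. -/
theorem eval_matForm_of_rank_one {k : ℕ} (N : Matrix (Fin (k + 1)) (Fin (k + 1)) ℂ)
    (z w : Fin 2 → ℂ) (x : Fin 4 → ℂ) (hx : twistMat x = Matrix.of fun i j => z i * w j) :
    MvPolynomial.eval x (matForm k N) =
      ∑ a : Fin (k + 1), binForm (N a) (w 0) (w 1) * (z 0 ^ (a : ℕ) * z 1 ^ (k - a)) := by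
  have hrow : ∀ a b : Fin (k + 1), symPow k (twistMat x) a b =
      (z 0 ^ (a : ℕ) * z 1 ^ (k - a)) *
        ((k.choose b : ℂ) * (w 0 ^ (b : ℕ) * w 1 ^ (k - b))) := by
    intro a b
    refine congrFun (binForm_injective (v := symPow k (twistMat x) a) (w := fun b =>
      (z 0 ^ (a : ℕ) * z 1 ^ (k - a)) * ((k.choose b : ℂ) * (w 0 ^ (b : ℕ) * w 1 ^ (k - b))))
      fun s t => ?_) b
    rw [binForm_symPow_row, hx]
    have := sum_binomial_mul k (w 0 * s) (w 1 * t)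
    calc _ = (z 0 ^ (a : ℕ) * z 1 ^ (k - a)) * (w 0 * s + w 1 * t) ^ k := by
          have : (w 0 * s + w 1 * t) ^ k =
              (w 0 * s + w 1 * t) ^ (a : ℕ) * (w 0 * s + w 1 * t) ^ (k - a) := by
            rw [← pow_add]; congr 1; omega
          rw [this]
          simp only [Matrix.of_apply, mul_assoc, ← mul_add, mul_pow]
          ring
      _ = _ := by
          rw [← this, binForm, Finset.mul_sum]
          exact Finset.sum_congr rfl fun i _ => by rw [mul_pow, mul_pow]; ring
  rw [eval_matForm]
  refine Finset.sum_congr rfl fun a _ => ?_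
  rw [binForm, Finset.sum_mul]
  refine Finset.sum_congr rfl fun b _ => ?_
  rw [hrow]
  field_simp [choose_ne_zero b]

/-- The map `(f, N) ↦ q f + matForm k N`, with `q` the norm form. -/
def stepMap (k : ℕ) : MvPolynomial (Fin 4) ℂ × Matrix (Fin (k + 1)) (Fin (k + 1)) ℂ →ₗ[ℂ]
    MvPolynomial (Fin 4) ℂ :=
  (LinearMap.mulLeft ℂ normForm).coprod (matForm k)

theorem stepMap_apply (k : ℕ) (f : MvPolynomial (Fin 4) ℂ)
    (N : Matrix (Fin (k + 1)) (Fin (k + 1)) ℂ) :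
    stepMap k (f, N) = normForm * f + matForm k N := rfl

/-- Restriction to the null cone of the norm form recovers `N`. -/
theorem stepMap_injective (k : ℕ) : Function.Injective (stepMap k) := by
  rw [injective_iff_map_eq_zero]
  rintro ⟨f, N⟩ h
  rw [stepMap_apply] at h
  have hN : N = 0 := by
    refine matrix_ext_of_binForm fun x y s t => ?_
    obtain ⟨p, hp⟩ := exists_twistMat_eq ![x, y] ![s, t]
    have h' := congrArg (MvPolynomial.eval p) h
    rw [map_add, map_mul, eval_normForm, eval_matForm_of_rank_one N _ _ p hp, hp,
      Matrix.det_fin_two] at h'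
    simp only [Matrix.of_apply, map_zero] at h'
    have h0 : ∀ a : Fin (k + 1), binForm ((0 : Matrix (Fin (k + 1)) (Fin (k + 1)) ℂ) a) s t = 0 :=
      fun a => by simp [binForm]
    simp only [h0, zero_mul, Finset.sum_const_zero]
    rw [← h']
    simp only [Matrix.cons_val_zero, Matrix.cons_val_one]
    ring
  rw [hN, map_zero, add_zero] at h
  rw [hN, (mul_eq_zero.1 h).resolve_left normForm_ne_zero]
  rfl

theorem finrank_homogeneousSubmodule (d : ℕ) :
    Module.finrank ℂ (MvPolynomial.homogeneousSubmodule (Fin 4) ℂ d) = (d + 3).choose 3 := by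
  rw [MvPolynomial.homogeneousSubmodule_eq_finsupp_supported,
    (AddMonoidAlgebra.supportedEquivFinsupp (R := ℂ) (S := ℂ)
      {d' : Fin 4 →₀ ℕ | d'.degree = d}).finrank_eq]
  have hs : {d' : Fin 4 →₀ ℕ | d'.degree = d} =
      (Finset.univ.finsuppAntidiag d : Finset (Fin 4 →₀ ℕ)) := by
    ext x
    simp [Finsupp.degree_eq_sum]
  rw [hs, Module.finrank_finsupp_self]
  simp only [Finset.coe_sort_coe, Fintype.card_coe]
  rw [Finset.card_finsuppAntidiag_nat_eq_choose, Finset.card_univ, Fintype.card_fin,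
    show 4 + d - 1 = d + 3 by omega, ← Nat.choose_symm_add]

instance (d : ℕ) : Module.Finite ℂ (MvPolynomial.homogeneousSubmodule (Fin 4) ℂ d) :=
  Module.Finite.iff_fg.2 (MvPolynomial.homogeneousSubmodule_fg (Fin 4) ℂ d)

theorem finrank_map_stepMap (k : ℕ) (A : Submodule ℂ (MvPolynomial (Fin 4) ℂ))
    (B : Submodule ℂ (Matrix (Fin (k + 1)) (Fin (k + 1)) ℂ)) [Module.Finite ℂ A] :
    Module.finrank ℂ ((A.prod B).map (stepMap k)) = Module.finrank ℂ A + Module.finrank ℂ B := by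
  rw [← (Submodule.equivMapOfInjective _ (stepMap_injective k) _).finrank_eq,
    ← Module.finrank_prod]
  exact LinearEquiv.finrank_eq
    { toFun := fun x => (⟨x.1.1, x.2.1⟩, ⟨x.1.2, x.2.2⟩)
      invFun := fun x => ⟨(x.1.1, x.2.1), x.1.2, x.2.2⟩
      map_add' := fun _ _ => rfl
      map_smul' := fun _ _ => rfl }

theorem choose_step (d : ℕ) :
    (d + 2 + 3).choose 3 = (d + 3).choose 3 + (d + 2 + 1) * (d + 2 + 1) := by
  have h (n : ℕ) : (n + 1).choose 2 + n.choose 2 = n * n := by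
    induction n with
    | zero => rfl
    | succ n ih =>
      rw [Nat.choose_succ_succ' (n + 1) 1, Nat.choose_succ_succ' n 1] at *
      simp only [Nat.choose_one_right] at *
      linarith
  rw [Nat.choose_succ_succ' (d + 4) 2, Nat.choose_succ_succ' (d + 3) 2]
  linarith [h (d + 3)]

theorem map_stepMap_homogeneous (d : ℕ) :
    ((MvPolynomial.homogeneousSubmodule (Fin 4) ℂ d).prod ⊤).map (stepMap (d + 2)) =
      MvPolynomial.homogeneousSubmodule (Fin 4) ℂ (d + 2) := by
  apply Submodule.eq_of_le_of_finrank_eq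
  · rintro _ ⟨⟨f, N⟩, ⟨hf, -⟩, rfl⟩
    rw [stepMap_apply]
    refine MvPolynomial.IsHomogeneous.add ?_ (matForm_isHomogeneous N)
    rw [add_comm d 2]
    exact normForm_isHomogeneous.mul hf
  · rw [finrank_map_stepMap, finrank_homogeneousSubmodule, finrank_homogeneousSubmodule,
      finrank_top, Module.finrank_matrix, choose_step]
    simp

/-- The matrices fixed by `N ↦ Symᵏ(a)ᵀ N Symᵏ(b)` for all `(a, b)` over `K`. -/
def invMat (K : Subgroup (SO3 × SO3)) (k : ℕ) :
    Submodule ℂ (Matrix (Fin (k + 1)) (Fin (k + 1)) ℂ) where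
  carrier := {N | ∀ a b : SU2, (cover3 a, cover3 b) ∈ K →
    (symPow k (a : Matrix (Fin 2) (Fin 2) ℂ)).transpose * N *
      symPow k (b : Matrix (Fin 2) (Fin 2) ℂ) = N}
  add_mem' := fun hM hN a b h => by rw [mul_add, add_mul, hM a b h, hN a b h]
  zero_mem' := fun a b _ => by simp
  smul_mem' := fun c N hN a b h => by rw [Matrix.mul_smul, Matrix.smul_mul, hN a b h]

theorem map_stepMap_invariant (K : Subgroup (SO3 × SO3)) (d : ℕ) :
    ((invariantForms (quaternary K) d).prod (invMat K (d + 2))).map (stepMap (d + 2)) =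
      invariantForms (quaternary K) (d + 2) := by
  have hsub : ∀ (a b : SU2) f N, substHom (cover4 (a, b)) (stepMap (d + 2) (f, N)) =
      stepMap (d + 2) (substHom (cover4 (a, b)) f,
        (symPow (d + 2) (a : Matrix (Fin 2) (Fin 2) ℂ)).transpose * N *
          symPow (d + 2) (b : Matrix (Fin 2) (Fin 2) ℂ)) := by
    intro a b f N
    rw [stepMap_apply, stepMap_apply, map_add, map_mul, substHom_normForm, substHom_matForm]
  apply le_antisymm
  · rintro _ ⟨⟨f, N⟩, ⟨hf, hN⟩, rfl⟩
    refine ⟨?_, ?_⟩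
    · exact (map_stepMap_homogeneous d).le ⟨(f, N), ⟨hf.1, trivial⟩, rfl⟩
    · rintro _ ⟨⟨a, b⟩, hab, rfl⟩
      rw [hsub, hf.2 _ ⟨(a, b), hab, rfl⟩, hN a b hab]
  · intro F hF
    obtain ⟨⟨f, N⟩, ⟨hf, -⟩, rfl⟩ := (map_stepMap_homogeneous d).ge hF.1
    have hinv : ∀ a b : SU2, (a, b) ∈ K.comap (cover3.prodMap cover3) → _ := fun a b hab =>
      Prod.ext_iff.1 (stepMap_injective (d + 2) ((hsub a b f N).symm.trans
        (hF.2 _ ⟨(a, b), hab, rfl⟩)))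
    refine ⟨(f, N), ⟨⟨hf, ?_⟩, fun a b hab => (hinv a b hab).2⟩, rfl⟩
    rintro _ ⟨⟨a, b⟩, hab, rfl⟩
    exact (hinv a b hab).1

theorem invariantForms_le (G : Subgroup SO4) (d : ℕ) :
    invariantForms G d ≤ MvPolynomial.homogeneousSubmodule (Fin 4) ℂ d := fun _ hf => hf.1

instance (G : Subgroup SO4) (d : ℕ) : Module.Finite ℂ (invariantForms G d) :=
  Submodule.finiteDimensional_of_le (invariantForms_le G d)

theorem m_add_two (K : Subgroup (SO3 × SO3)) (d : ℕ) :
    m (quaternary K) (d + 2) = m (quaternary K) d + Module.finrank ℂ (invMat K (d + 2)) := by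
  rw [m, ← map_stepMap_invariant, finrank_map_stepMap, m]

theorem m_zero (G : Subgroup SO4) : m G 0 = 1 := by
  have : invariantForms G 0 = MvPolynomial.homogeneousSubmodule (Fin 4) ℂ 0 := by
    refine le_antisymm (invariantForms_le G 0) fun f hf => ⟨hf, fun g _ => ?_⟩
    rw [MvPolynomial.mem_homogeneousSubmodule, ← MvPolynomial.totalDegree_zero_iff_isHomogeneous,
      MvPolynomial.totalDegree_eq_zero_iff_eq_C] at hf
    rw [hf, substHom, MvPolynomial.algHom_C, MvPolynomial.algebraMap_eq]
  rw [m, this, finrank_homogeneousSubmodule]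
  rfl

end

/-! ### Invariant matrices and invariant binary forms -/

/-- The coefficient vectors of the binary forms of degree `k` invariant under the preimage of `G`
in `SU(2)`. -/
def invVec (G : Subgroup SO3) (k : ℕ) : Submodule ℂ (Fin (k + 1) → ℂ) where
  carrier := {v | ∀ a : SU2, cover3 a ∈ G →
    Matrix.vecMul v (symPow k (a : Matrix (Fin 2) (Fin 2) ℂ)) = v}
  add_mem' := fun hv hw a h => by rw [Matrix.add_vecMul, hv a h, hw a h]
  zero_mem' := fun a _ => Matrix.zero_vecMul _
  smul_mem' := fun c v hv a h => by rw [Matrix.smul_vecMul, hv a h]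

theorem invVec_mono {G G' : Subgroup SO3} (h : G ≤ G') (k : ℕ) : invVec G' k ≤ invVec G k :=
  fun _ hv a ha => hv a (h ha)

theorem invMat_mono {K K' : Subgroup (SO3 × SO3)} (h : K ≤ K') (k : ℕ) :
    invMat K' k ≤ invMat K k :=
  fun _ hN a b hab => hN a b (h hab)

theorem cover3_eq_one {a : SU2} (h : cover3 a = 1) :
    (a : Matrix (Fin 2) (Fin 2) ℂ) = 1 ∨ (a : Matrix (Fin 2) (Fin 2) ℂ) = -1 := by
  obtain ⟨u, hu, h1⟩ := exists_quatMat a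
  have hr : rotMat (quatMat u) = 1 := by
    rw [← hu]; exact congrArg Subtype.val h
  rw [rotMat_quatMat] at hr
  have e0 := congrFun (congrFun hr 0) 0
  have e1 := congrFun (congrFun hr 1) 1
  simp at e0 e1
  have hu1 : u 1 = 0 := by nlinarith [sq_nonneg (u 1), sq_nonneg (u 2), sq_nonneg (u 3)]
  have hu2 : u 2 = 0 := by nlinarith [sq_nonneg (u 1), sq_nonneg (u 2), sq_nonneg (u 3)]
  have hu3 : u 3 = 0 := by nlinarith [sq_nonneg (u 1), sq_nonneg (u 2), sq_nonneg (u 3)]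
  have h0 : u 0 = 1 ∨ u 0 = -1 := by
    rw [hu1, hu2, hu3] at h1
    exact sq_eq_one_iff.1 (by linarith)
  rw [hu]
  rcases h0 with h0 | h0
  · left; ext i j; fin_cases i <;> fin_cases j <;> simp [quatMat, h0, hu1, hu2, hu3]
  · right; ext i j; fin_cases i <;> fin_cases j <;> simp [quatMat, h0, hu1, hu2, hu3]

theorem symPow_eq_one_of_cover3_eq_one {k : ℕ} (hk : Even k) {a : SU2} (h : cover3 a = 1) :
    symPow k (a : Matrix (Fin 2) (Fin 2) ℂ) = 1 := by
  rcases cover3_eq_one h with h | h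
  · rw [h, symPow_one]
  · refine Eq.trans ?_ (symPow_one (k := k))
    rw [h]
    have hrow : ∀ i : Fin (k + 1), symPow k (-1 : Matrix (Fin 2) (Fin 2) ℂ) i =
        symPow k (1 : Matrix (Fin 2) (Fin 2) ℂ) i := by
      refine fun i => binForm_injective fun s t => ?_
      rw [binForm_symPow_row, binForm_symPow_row]
      have h2 : ((-1 : ℂ)) ^ (i : ℕ) * (-1) ^ (k - i) = 1 := by
        rw [← pow_add, show (i : ℕ) + (k - i) = k by omega, hk.neg_one_pow]
      simp only [Matrix.neg_apply, Matrix.one_apply_eq, ne_eq, one_ne_zero, zero_ne_one,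
        not_false_eq_true, Matrix.one_apply_ne, neg_zero, zero_mul, add_zero, zero_add, one_mul,
        neg_mul]
      rw [neg_pow s, neg_pow t]
      linear_combination (s ^ (i : ℕ) * t ^ (k - i)) * h2
    ext i j
    exact congrFun (hrow i) j

/-- The pairs `(a, b)` fixing the matrix `N`. -/
def matStabilizer {k : ℕ} (N : Matrix (Fin (k + 1)) (Fin (k + 1)) ℂ) : Subgroup (SU2 × SU2) where
  carrier := {p | (symPow k (p.1 : Matrix (Fin 2) (Fin 2) ℂ)).transpose * N *
    symPow k (p.2 : Matrix (Fin 2) (Fin 2) ℂ) = N}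
  mul_mem' := by
    rintro ⟨a, b⟩ ⟨a', b'⟩ h h'
    simp only [Set.mem_ofPred_eq, Prod.mk_mul_mk, Submonoid.coe_mul, symPow_mul,
      Matrix.transpose_mul] at h h' ⊢
    conv_rhs => rw [← h', ← h]
    simp only [mul_assoc]
  one_mem' := by simp [symPow_one]
  inv_mem' := by
    rintro ⟨a, b⟩ h
    have e : ∀ a : SU2, symPow k (a : Matrix (Fin 2) (Fin 2) ℂ) *
        symPow k ((a⁻¹ : SU2) : Matrix (Fin 2) (Fin 2) ℂ) = 1 := fun a => by
      rw [← symPow_mul, ← Submonoid.coe_mul, mul_inv_cancel, Submonoid.coe_one, symPow_one]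
    simp only [Set.mem_ofPred_eq, Prod.inv_mk] at h ⊢
    conv_lhs => rw [← h]
    simp only [mul_assoc]
    rw [e b, mul_one, ← mul_assoc, ← Matrix.transpose_mul, e a, Matrix.transpose_one, one_mul]

/-- In even degree it suffices to lift enough elements of `K` to pairs fixing `N`, since the kernel
of the covering acts trivially. -/
theorem mem_invMat_of_le {k : ℕ} (hk : Even k) {K : Subgroup (SO3 × SO3)}
    {N : Matrix (Fin (k + 1)) (Fin (k + 1)) ℂ}
    (h : K ≤ (matStabilizer N).map (cover3.prodMap cover3)) : N ∈ invMat K k := by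
  intro a b hab
  obtain ⟨⟨a', b'⟩, hN, he⟩ := h hab
  have he1 : cover3 a' = cover3 a := congrArg Prod.fst he
  have he2 : cover3 b' = cover3 b := congrArg Prod.snd he
  have key : (a'⁻¹ * a, b'⁻¹ * b) ∈ matStabilizer N := by
    have h1 := symPow_eq_one_of_cover3_eq_one hk (a := a'⁻¹ * a) (by simp [he1])
    have h2 := symPow_eq_one_of_cover3_eq_one hk (a := b'⁻¹ * b) (by simp [he2])
    change _ * N * _ = N
    rw [h1, h2]
    simp
  have := mul_mem hN key
  rw [Prod.mk_mul_mk, mul_inv_cancel_left, mul_inv_cancel_left] at this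
  exact this

/-- The elements of `SU(2)` fixing the vector `v`. -/
def vecStabilizer {k : ℕ} (v : Fin (k + 1) → ℂ) : Subgroup SU2 where
  carrier := {a | Matrix.vecMul v (symPow k (a : Matrix (Fin 2) (Fin 2) ℂ)) = v}
  mul_mem' := by
    intro a b h h'
    simp only [Set.mem_ofPred_eq, Submonoid.coe_mul, symPow_mul] at h h' ⊢
    rw [← Matrix.vecMul_vecMul, h, h']
  one_mem' := by simp [symPow_one]
  inv_mem' := by
    intro a h
    simp only [Set.mem_ofPred_eq] at h ⊢
    conv_lhs => rw [← h]
    rw [Matrix.vecMul_vecMul, ← symPow_mul, ← Submonoid.coe_mul, mul_inv_cancel,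
      Submonoid.coe_one, symPow_one, Matrix.vecMul_one]

/-- In even degree, invariance under `⟨s⟩` may be tested on one lift of each generator. -/
theorem mem_invVec_closure {k : ℕ} (hk : Even k) {s : Set SO3} {v : Fin (k + 1) → ℂ}
    (h : ∀ g ∈ s, ∃ a : SU2, cover3 a = g ∧
      Matrix.vecMul v (symPow k (a : Matrix (Fin 2) (Fin 2) ℂ)) = v) :
    v ∈ invVec (Subgroup.closure s) k := by
  have hle : Subgroup.closure s ≤ (vecStabilizer v).map cover3 := by
    rw [Subgroup.closure_le]
    intro g hg
    obtain ⟨a, ha, hv⟩ := h g hg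
    exact ⟨a, hv, ha⟩
  intro a ha
  obtain ⟨a', hv, he⟩ := hle ha
  have key : a'⁻¹ * a ∈ vecStabilizer v := by
    change Matrix.vecMul v _ = v
    rw [symPow_eq_one_of_cover3_eq_one hk (a := a'⁻¹ * a) (by simp [he]), Matrix.vecMul_one]
  have := mul_mem hv key
  rwa [mul_inv_cancel_left] at this

/-- The matrix `∑ Cᵢⱼ eᵢ ⊗ fⱼ`, where `eᵢ` and `fⱼ` are the rows of `E` and `F`. -/
def tensorMap {ι κ : Type*} [Fintype ι] [Fintype κ] {k : ℕ} (E : Matrix ι (Fin (k + 1)) ℂ)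
    (F : Matrix κ (Fin (k + 1)) ℂ) :
    Matrix ι κ ℂ →ₗ[ℂ] Matrix (Fin (k + 1)) (Fin (k + 1)) ℂ where
  toFun C := E.transpose * C * F
  map_add' C C' := by rw [Matrix.mul_add, Matrix.add_mul]
  map_smul' c C := by rw [Matrix.mul_smul, Matrix.smul_mul]; rfl

section Tensor

variable {ι κ : Type*} [Fintype ι] [Fintype κ] {k : ℕ} {E : Matrix ι (Fin (k + 1)) ℂ}
  {F : Matrix κ (Fin (k + 1)) ℂ}

theorem mul_right_injective_of_linearIndependent {ν : Type*}
    (hF : LinearIndependent ℂ (fun i => F i)) {C D : Matrix ν κ ℂ} (h : C * F = D * F) : C = D := by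
  funext i
  exact Matrix.vecMul_injective_iff.2 hF (congrFun h i)

theorem mul_left_injective_of_linearIndependent {ν : Type*}
    (hE : LinearIndependent ℂ (fun i => E i)) {C D : Matrix ι ν ℂ}
    (h : E.transpose * C = E.transpose * D) : C = D := by
  have h2 := congrArg Matrix.transpose h
  rw [Matrix.transpose_mul, Matrix.transpose_mul, Matrix.transpose_transpose] at h2
  exact Matrix.transpose_injective (mul_right_injective_of_linearIndependent hE h2)

theorem tensorMap_injective (hE : LinearIndependent ℂ (fun i => E i))
    (hF : LinearIndependent ℂ (fun i => F i)) : Function.Injective (tensorMap E F) := by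
  intro C D h
  have h1 : E.transpose * C = E.transpose * D := mul_right_injective_of_linearIndependent hF h
  exact mul_left_injective_of_linearIndependent hE h1

theorem exists_mul_eq_of_rows_mem {ν : Type*} {N : Matrix ν (Fin (k + 1)) ℂ}
    (h : ∀ i, N i ∈ Submodule.span ℂ (Set.range fun j => F j)) : ∃ C : Matrix ν κ ℂ, N = C * F := by
  choose c hc using fun i => (Submodule.mem_span_range_iff_exists_fun ℂ).1 (h i)
  refine ⟨Matrix.of c, ?_⟩
  ext i j
  rw [← hc i, Matrix.mul_apply]
  simp

/-- Invariance under a product means that the columns are invariant under the first factor and the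
rows under the second. -/
theorem mem_invMat_prod_iff {G₁ G₂ : Subgroup SO3} {N : Matrix (Fin (k + 1)) (Fin (k + 1)) ℂ} :
    N ∈ invMat (G₁.prod G₂) k ↔ (∀ i, N.transpose i ∈ invVec G₁ k) ∧ ∀ i, N i ∈ invVec G₂ k := by
  constructor
  · intro h
    refine ⟨fun i a ha => ?_, fun i b hb => ?_⟩
    · have := h a 1 ⟨ha, by simp [one_mem]⟩
      rw [Submonoid.coe_one, symPow_one, mul_one] at this
      have := congrArg Matrix.transpose this
      rw [Matrix.transpose_mul, Matrix.transpose_transpose] at this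
      exact congrFun this i
    · have := h 1 b ⟨by simp [one_mem], hb⟩
      rw [Submonoid.coe_one, symPow_one, Matrix.transpose_one, one_mul] at this
      exact congrFun this i
  · rintro ⟨h1, h2⟩ a b ⟨ha, hb⟩
    have e1 : N.transpose * symPow k (a : Matrix (Fin 2) (Fin 2) ℂ) = N.transpose :=
      funext fun i => h1 i a ha
    have e2 : N * symPow k (b : Matrix (Fin 2) (Fin 2) ℂ) = N := funext fun i => h2 i b hb
    have e1' := congrArg Matrix.transpose e1
    rw [Matrix.transpose_mul, Matrix.transpose_transpose] at e1'
    rw [e1', e2]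

theorem invMat_prod_eq_range {G₁ G₂ : Subgroup SO3}
    (hE : Submodule.span ℂ (Set.range fun i => E i) = invVec G₁ k)
    (hEi : LinearIndependent ℂ (fun i => E i))
    (hF : Submodule.span ℂ (Set.range fun i => F i) = invVec G₂ k) :
    invMat (G₁.prod G₂) k = LinearMap.range (tensorMap E F) := by
  have hE' : ∀ i, E i ∈ invVec G₁ k := fun i => hE ▸ Submodule.subset_span ⟨i, rfl⟩
  have hF' : ∀ i, F i ∈ invVec G₂ k := fun i => hF ▸ Submodule.subset_span ⟨i, rfl⟩
  ext N
  rw [mem_invMat_prod_iff]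
  constructor
  · rintro ⟨h1, h2⟩
    obtain ⟨C, hC⟩ := exists_mul_eq_of_rows_mem (F := E) fun i => hE ▸ h1 i
    have hN : N = E.transpose * C.transpose := by
      rw [← Matrix.transpose_mul, ← hC, Matrix.transpose_transpose]
    obtain ⟨D, hD⟩ := exists_mul_eq_of_rows_mem (F := F) (N := C.transpose) fun i => by
      rw [hF]
      intro b hb
      have hNb : N * symPow k (b : Matrix (Fin 2) (Fin 2) ℂ) = N := funext fun i => h2 i b hb
      rw [hN, Matrix.mul_assoc] at hNb
      exact congrFun (mul_left_injective_of_linearIndependent hEi hNb) i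
    exact ⟨D, by rw [hN, hD]; exact Matrix.mul_assoc _ _ _⟩
  · rintro ⟨C, rfl⟩
    refine ⟨fun i a ha => ?_, fun i b hb => ?_⟩
    · have : E * symPow k (a : Matrix (Fin 2) (Fin 2) ℂ) = E := funext fun i => hE' i a ha
      have : (tensorMap E F C).transpose * symPow k (a : Matrix (Fin 2) (Fin 2) ℂ) =
          (tensorMap E F C).transpose := by
        simp only [tensorMap, LinearMap.coe_mk, AddHom.coe_mk, Matrix.transpose_mul,
          Matrix.transpose_transpose, Matrix.mul_assoc, this]
      exact congrFun this i
    · have : F * symPow k (b : Matrix (Fin 2) (Fin 2) ℂ) = F := funext fun i => hF' i b hb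
      have : tensorMap E F C * symPow k (b : Matrix (Fin 2) (Fin 2) ℂ) = tensorMap E F C := by
        simp only [tensorMap, LinearMap.coe_mk, AddHom.coe_mk, Matrix.mul_assoc, this]
      exact congrFun this i

end Tensor

theorem exists_rows_basis {k : ℕ} (W : Submodule ℂ (Fin (k + 1) → ℂ)) :
    ∃ E : Matrix (Fin (Module.finrank ℂ W)) (Fin (k + 1)) ℂ,
      Submodule.span ℂ (Set.range fun i => E i) = W ∧ LinearIndependent ℂ (fun i => E i) := by
  refine ⟨Matrix.of fun i => (Module.finBasis ℂ W i : Fin (k + 1) → ℂ), ?_, ?_⟩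
  · have := congrArg (Submodule.map W.subtype) (Module.finBasis ℂ W).span_eq
    rwa [Submodule.map_span, Submodule.map_top, Submodule.range_subtype, ← Set.range_comp] at this
  · have : LinearIndependent ℂ (W.subtype ∘ Module.finBasis ℂ W) :=
      (Module.finBasis ℂ W).linearIndependent.map' _ (Submodule.ker_subtype _)
    exact this

theorem finrank_invMat_prod (G₁ G₂ : Subgroup SO3) (k : ℕ) :
    Module.finrank ℂ (invMat (G₁.prod G₂) k) =
      Module.finrank ℂ (invVec G₁ k) * Module.finrank ℂ (invVec G₂ k) := by
  obtain ⟨E, hE, hEi⟩ := exists_rows_basis (invVec G₁ k)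
  obtain ⟨F, hF, hFi⟩ := exists_rows_basis (invVec G₂ k)
  rw [invMat_prod_eq_range hE hEi hF, LinearMap.finrank_range_of_inj (tensorMap_injective hEi hFi),
    Module.finrank_matrix]
  simp

/-! ### Coordinate spaces cut out by a signed involution -/

/-- The vectors supported on `p` that transform by the sign `(-1)ⁿ` under `σ`. -/
def orbitSpace {ι : Type*} (p : ι → Prop) (σ : ι → ι) (n : ℕ) : Submodule ℂ (ι → ℂ) where
  carrier := {c | (∀ i, ¬ p i → c i = 0) ∧ ∀ i, c (σ i) = (-1) ^ n * c i}
  add_mem' := fun ha hb => ⟨fun i hi => by simp [ha.1 i hi, hb.1 i hi],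
    fun i => by simp [ha.2 i, hb.2 i, mul_add]⟩
  zero_mem' := by simp
  smul_mem' := fun c a ha => ⟨fun i hi => by simp [ha.1 i hi],
    fun i => by simp [ha.2 i, mul_left_comm]⟩

/-- The dimension is the number of orbits of `σ` on `p`, fixed points counting only for the
trivial sign. Each orbit is represented by its member of least label `κ`. -/
theorem finrank_orbitSpace {ι : Type*} [Fintype ι] [DecidableEq ι] (p : ι → Prop) [DecidablePred p]
    (σ : ι → ι) (n : ℕ) (κ : ι → ℕ) (hκ : Function.Injective κ) (hσ : Function.Involutive σ)
    (hp : ∀ i, p i → p (σ i)) :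
    Module.finrank ℂ (orbitSpace p σ n) =
      (Finset.univ.filter fun i => p i ∧ (κ i < κ (σ i) ∨ (σ i = i ∧ Even n))).card := by
  set r : ι → Prop := fun i => p i ∧ (κ i < κ (σ i) ∨ (σ i = i ∧ Even n)) with hr
  have hε : ((-1 : ℂ)) ^ n * (-1) ^ n = 1 := by rw [← mul_pow]; simp
  have hrσ : ∀ i, r i → r (σ i) → σ i = i ∧ Even n := by
    rintro i ⟨-, h⟩ ⟨-, h'⟩
    rw [hσ i] at h'
    rcases h with h | h
    · rcases h' with h' | h'
      · omega
      · exact absurd h (by rw [← h'.1]; exact lt_irrefl _)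
    · exact h
  let L : orbitSpace p σ n →ₗ[ℂ] ({i // r i} → ℂ) :=
    (LinearMap.funLeft ℂ ℂ (Subtype.val : {i // r i} → ι)).comp (orbitSpace p σ n).subtype
  have hL : Function.Bijective L := by
    constructor
    · rw [injective_iff_map_eq_zero]
      rintro ⟨c, hc1, hc2⟩ h
      have h0 : ∀ i, r i → c i = 0 := fun i hi => congrFun h ⟨i, hi⟩
      ext i
      change c i = 0
      by_cases hpi : p i
      · rcases lt_trichotomy (κ i) (κ (σ i)) with hlt | heq | hgt
        · exact h0 i ⟨hpi, Or.inl hlt⟩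
        · have hfix := (hκ heq).symm
          rcases Nat.even_or_odd n with hn | hn
          · exact h0 i ⟨hpi, Or.inr ⟨hfix, hn⟩⟩
          · have := hc2 i
            rw [hfix, hn.neg_one_pow] at this
            linear_combination this / 2
        · have h1 := h0 (σ i) ⟨hp i hpi, Or.inl (by rwa [hσ i])⟩
          have h2 := hc2 (σ i)
          rwa [hσ i, h1, mul_zero] at h2
      · exact hc1 i hpi
    · intro x
      refine ⟨⟨fun i => if h : r i then x ⟨i, h⟩ else
        if h : r (σ i) then (-1) ^ n * x ⟨σ i, h⟩ else 0, ?_, ?_⟩, ?_⟩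
      · intro i hi
        have h1 : ¬ r i := fun h => hi h.1
        have h2 : ¬ r (σ i) := fun h => hi (by simpa [hσ i] using hp _ h.1)
        simp only [h1, h2, dite_false]
      · intro i
        by_cases h1 : r i
        · by_cases h2 : r (σ i)
          · obtain ⟨hf, hn⟩ := hrσ i h1 h2
            simp only [h1, h2, dite_true, hn.neg_one_pow, one_mul]
            congr 1
            exact Subtype.ext hf
          · have h3 : r (σ (σ i)) := by rwa [hσ i]
            simp only [h1, h2, h3, dite_true, dite_false]
            congr 2
            exact Subtype.ext (hσ i)
        · have h3 : ¬ r (σ (σ i)) := by rwa [hσ i]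
          by_cases h2 : r (σ i)
          · simp only [h1, h2, dite_true, dite_false]
            rw [← mul_assoc, hε, one_mul]
          · simp only [h1, h2, h3, dite_false, mul_zero]
      · funext i
        change (if h : r i then x ⟨i, h⟩ else _) = _
        rw [dif_pos i.2]
  rw [(LinearEquiv.ofBijective L hL).finrank_eq, Module.finrank_fintype_fun_eq_card,
    Fintype.card_subtype]

/-! ### Lifts of the generators to unit quaternions -/

theorem quatMat_mem (u : Fin 4 → ℝ) (hu : u 0 ^ 2 + u 1 ^ 2 + u 2 ^ 2 + u 3 ^ 2 = 1) :
    quatMat u ∈ Matrix.specialUnitaryGroup (Fin 2) ℂ := by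
  have hu' : (u 0 : ℂ) ^ 2 + (u 1 : ℂ) ^ 2 + (u 2 : ℂ) ^ 2 + (u 3 : ℂ) ^ 2 = 1 := by
    exact_mod_cast hu
  have hI := Complex.I_sq
  rw [Matrix.mem_specialUnitaryGroup_iff, Matrix.mem_unitaryGroup_iff]
  constructor
  · ext i j
    fin_cases i <;> fin_cases j <;>
      simp [quatMat, Matrix.mul_apply, Fin.sum_univ_succ, Matrix.star_apply] <;> grind
  · simp [quatMat, Matrix.det_fin_two]
    grind

/-- The element of `SU(2)` given by a unit quaternion. -/
def unitQuat (u : Fin 4 → ℝ) (hu : u 0 ^ 2 + u 1 ^ 2 + u 2 ^ 2 + u 3 ^ 2 = 1) : SU2 :=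
  ⟨quatMat u, quatMat_mem u hu⟩

theorem cover3_unitQuat_eq {u : Fin 4 → ℝ} (hu : u 0 ^ 2 + u 1 ^ 2 + u 2 ^ 2 + u 3 ^ 2 = 1)
    {g : SO3} (h : rotMat (quatMat u) = (g : Matrix (Fin 3) (Fin 3) ℝ)) :
    cover3 (unitQuat u hu) = g := Subtype.ext h

/-- The quaternion `i`, a lift of `A₁`. -/
def liftA₁ : SU2 := unitQuat ![0, 1, 0, 0] (by simp)

/-- The quaternion `j`, a lift of `A₂`. -/
def liftA₂ : SU2 := unitQuat ![0, 0, 1, 0] (by simp)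

/-- The quaternion `cos (π / n) + sin (π / n) i`, a lift of `Rₙ`. -/
def liftR (n : ℕ) : SU2 :=
  unitQuat ![Real.cos (Real.pi / n), Real.sin (Real.pi / n), 0, 0] (by simp)

/-- The quaternion `(1 + i - j + k) / 2`, a lift of `S`. -/
def liftS : SU2 := unitQuat ![1 / 2, 1 / 2, -1 / 2, 1 / 2] (by simp; norm_num)

/-- The quaternion `(τ + (τ - 1) j + k) / 2`, a lift of `U`. -/
def liftU : SU2 :=
  unitQuat ![Real.goldenRatio / 2, 0, (Real.goldenRatio - 1) / 2, 1 / 2] (by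
    have h := Real.goldenRatio_sq
    simp
    linear_combination (1 / 2) * h)

theorem cover3_liftA₁ : cover3 liftA₁ = A₁ := by
  refine cover3_unitQuat_eq _ ?_
  rw [rotMat_quatMat]
  ext i j
  fin_cases i <;> fin_cases j <;> simp [A₁]

theorem cover3_liftA₂ : cover3 liftA₂ = A₂ := by
  refine cover3_unitQuat_eq _ ?_
  rw [rotMat_quatMat]
  ext i j
  fin_cases i <;> fin_cases j <;> simp [A₂]

theorem cover3_liftR (n : ℕ) : cover3 (liftR n) = R n := by
  refine cover3_unitQuat_eq _ ?_
  rw [rotMat_quatMat]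
  have h1 : 2 * Real.pi / n = 2 * (Real.pi / n) := by ring
  have h2 := Real.sin_sq_add_cos_sq (Real.pi / n)
  ext i j
  fin_cases i <;> fin_cases j <;> simp [R, h1, Real.cos_two_mul, Real.sin_two_mul] <;>
    linarith

theorem cover3_liftS : cover3 liftS = S := by
  refine cover3_unitQuat_eq _ ?_
  rw [rotMat_quatMat]
  ext i j
  fin_cases i <;> fin_cases j <;> simp [S] <;> norm_num

theorem cover3_liftU : cover3 liftU = U := by
  refine cover3_unitQuat_eq _ ?_
  rw [rotMat_quatMat]
  have h := Real.goldenRatio_sq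
  ext i j
  fin_cases i <;> fin_cases j <;> simp [U] <;> grind

theorem vecMul_symPow_eq_iff {k : ℕ} {v w : Fin (k + 1) → ℂ} {m : Matrix (Fin 2) (Fin 2) ℂ} :
    Matrix.vecMul v (symPow k m) = w ↔
      ∀ s t, binForm v (m 0 0 * s + m 0 1 * t) (m 1 0 * s + m 1 1 * t) = binForm w s t := by
  constructor
  · rintro rfl s t
    rw [binForm_vecMul_symPow]
  · intro h
    refine binForm_injective fun s t => ?_
    rw [binForm_vecMul_symPow, h]

/-! ### Invariants of the dihedral groups -/

theorem vecMul_symPow_liftR {l n : ℕ} (v : Fin (2 * l + 1) → ℂ) :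
    Matrix.vecMul v (symPow (2 * l) (liftR n : Matrix (Fin 2) (Fin 2) ℂ)) = fun i =>
      v i * Complex.exp (2 * Real.pi * Complex.I * (((i : ℕ) : ℤ) - (l : ℤ) : ℤ) / n) := by
  have h0 : (liftR n : Matrix (Fin 2) (Fin 2) ℂ) =
      !![Complex.exp (Real.pi * Complex.I / n), 0;
         0, Complex.exp (-(Real.pi * Complex.I / n))] := by
    have e : (Real.pi * Complex.I / n : ℂ) = ((Real.pi / n : ℝ) : ℂ) * Complex.I := by
      push_cast; ring
    rw [e, ← neg_mul, Complex.exp_mul_I, Complex.exp_mul_I, Complex.cos_neg, Complex.sin_neg]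
    ext i j
    fin_cases i <;> fin_cases j <;> simp [liftR, unitQuat, quatMat]
    ring
  rw [vecMul_symPow_eq_iff]
  intro s t
  rw [h0]
  simp only [binForm, Matrix.of_apply, Matrix.cons_val', Matrix.cons_val_zero, Matrix.cons_val_one,
    Matrix.cons_val_fin_one, zero_mul, add_zero, zero_add]
  refine Finset.sum_congr rfl fun i _ => ?_
  rw [mul_pow, mul_pow, ← Complex.exp_nat_mul, ← Complex.exp_nat_mul]
  have : Complex.exp (2 * Real.pi * Complex.I * (((i : ℕ) : ℤ) - (l : ℤ) : ℤ) / n) =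
      Complex.exp ((i : ℕ) * (Real.pi * Complex.I / n)) *
        Complex.exp (((2 * l - i : ℕ) : ℂ) * -(Real.pi * Complex.I / n)) := by
    rw [← Complex.exp_add, Nat.cast_sub (by omega)]
    congr 1
    push_cast
    ring
  rw [this]
  ring

theorem vecMul_symPow_liftA₂ {l : ℕ} (v : Fin (2 * l + 1) → ℂ) :
    Matrix.vecMul v (symPow (2 * l) (liftA₂ : Matrix (Fin 2) (Fin 2) ℂ)) =
      fun i : Fin (2 * l + 1) =>
      (-1) ^ (i : ℕ) * v (Fin.rev i) := by
  rw [vecMul_symPow_eq_iff]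
  intro s t
  simp only [binForm]
  rw [← Equiv.sum_comp Fin.revPerm]
  refine Finset.sum_congr rfl fun i _ => ?_
  have e1 : ((Fin.revPerm i : Fin (2 * l + 1)) : ℕ) = 2 * l - i := by
    rw [Fin.revPerm_apply, Fin.val_rev]; omega
  have e2 : 2 * l - (2 * l - (i : ℕ)) = i := by omega
  rw [e1, e2, Fin.revPerm_apply]
  simp [liftA₂, unitQuat, quatMat]
  rw [neg_pow s]
  ring

theorem exp_eq_one_iff_dvd {n : ℕ} (hn : n ≠ 0) (k : ℤ) :
    Complex.exp (2 * Real.pi * Complex.I * (k : ℤ) / n) = 1 ↔ (n : ℤ) ∣ k := by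
  have hn' : (n : ℂ) ≠ 0 := by exact_mod_cast hn
  have hpi : (Real.pi : ℂ) ≠ 0 := by exact_mod_cast Real.pi_ne_zero
  have hI := Complex.I_ne_zero
  rw [Complex.exp_eq_one_iff]
  constructor
  · rintro ⟨c, hc⟩
    refine ⟨c, ?_⟩
    field_simp at hc
    have : (k : ℂ) = n * c := by linear_combination hc
    exact_mod_cast this
  · rintro ⟨c, rfl⟩
    refine ⟨c, ?_⟩
    push_cast
    field_simp

/-- The weights of an invariant of `Dₙ` are multiples of `n`, and `A₂` exchanges opposite weights.
For even `n` the sign of this exchange depends on the degree only. -/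
theorem invVec_dihedral {n : ℕ} (hn : n ≠ 0) (he : Even n) (l : ℕ) :
    invVec (D n) (2 * l) =
      orbitSpace (fun i : Fin (2 * l + 1) => (n : ℤ) ∣ (i : ℕ) - (l : ℤ)) Fin.rev l := by
  have hpar : ∀ i : Fin (2 * l + 1), (n : ℤ) ∣ (i : ℕ) - (l : ℤ) →
      ((-1 : ℂ)) ^ (i : ℕ) = (-1) ^ l := by
    intro i hi
    obtain ⟨c, hc⟩ := he
    have h2 : (2 : ℤ) ∣ (i : ℕ) - (l : ℤ) := dvd_trans ⟨c, by omega⟩ hi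
    rw [neg_one_pow_eq_pow_mod_two, neg_one_pow_eq_pow_mod_two (n := l)]
    congr 1
    omega
  have hrev : ∀ i : Fin (2 * l + 1), (n : ℤ) ∣ (i : ℕ) - (l : ℤ) →
      (n : ℤ) ∣ (Fin.rev i : ℕ) - (l : ℤ) := by
    intro i hi
    have : ((Fin.rev i : ℕ) : ℤ) - (l : ℤ) = -((i : ℕ) - (l : ℤ)) := by
      rw [Fin.val_rev]; omega
    rw [this]
    exact hi.neg_right
  have hk : Even (2 * l) := even_two_mul l
  ext v
  constructor
  · intro hv
    have h1 := hv (liftR n) (by rw [cover3_liftR]; exact Subgroup.subset_closure (by simp))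
    have h2 := hv liftA₂ (by rw [cover3_liftA₂]; exact Subgroup.subset_closure (by simp))
    rw [vecMul_symPow_liftR] at h1
    rw [vecMul_symPow_liftA₂] at h2
    have h0 : ∀ i : Fin (2 * l + 1), ¬ ((n : ℤ) ∣ (i : ℕ) - (l : ℤ)) → v i = 0 := by
      intro i hi
      by_contra h
      exact hi ((exp_eq_one_iff_dvd hn _).1 (mul_left_cancel₀ h ((congrFun h1 i).trans
        (mul_one _).symm)))
    refine ⟨h0, fun i => ?_⟩
    by_cases hi : (n : ℤ) ∣ (i : ℕ) - (l : ℤ)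
    · rw [← hpar i hi]
      conv_rhs => rw [← congrFun h2 i]
      rw [← mul_assoc, ← mul_pow]
      simp
    · rw [h0 i hi, h0 (Fin.rev i) fun h => hi (by simpa using hrev _ h), mul_zero]
  · rintro ⟨h1, h2⟩
    refine mem_invVec_closure hk ?_
    rintro g (rfl | rfl)
    · refine ⟨liftA₂, cover3_liftA₂, ?_⟩
      rw [vecMul_symPow_liftA₂]
      funext i
      rw [h2]
      by_cases hi : (n : ℤ) ∣ (i : ℕ) - (l : ℤ)
      · rw [hpar i hi, ← mul_assoc, ← mul_pow]
        simp
      · rw [h1 i hi, mul_zero, mul_zero]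
    · refine ⟨liftR n, cover3_liftR n, ?_⟩
      rw [vecMul_symPow_liftR]
      funext i
      by_cases hi : (n : ℤ) ∣ (i : ℕ) - (l : ℤ)
      · rw [(exp_eq_one_iff_dvd hn _).2 hi, mul_one]
      · rw [h1 i hi, zero_mul]

theorem finrank_invVec_dihedral {n : ℕ} (hn : n ≠ 0) (he : Even n) (l : ℕ) :
    Module.finrank ℂ (invVec (D n) (2 * l)) =
      (Finset.univ.filter fun i : Fin (2 * l + 1) => (n : ℤ) ∣ (i : ℕ) - (l : ℤ) ∧
        ((i : ℕ) < (Fin.rev i : ℕ) ∨ (Fin.rev i = i ∧ Even l))).card := by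
  rw [invVec_dihedral hn he, finrank_orbitSpace _ _ _
    (fun i : Fin (2 * l + 1) => (i : ℕ)) Fin.val_injective
    Fin.rev_rev]
  intro i hi
  have : ((Fin.rev i : ℕ) : ℤ) - (l : ℤ) = -((i : ℕ) - (l : ℤ)) := by
    rw [Fin.val_rev]; omega
  rw [this]
  exact hi.neg_right

/-- In degree less than `n` only the weight zero contributes. -/
theorem finrank_invVec_dihedral_of_lt {n l : ℕ} (he : Even n) (hl : l < n) :
    Module.finrank ℂ (invVec (D n) (2 * l)) = if Even l then 1 else 0 := by
  rw [finrank_invVec_dihedral (by omega) he]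
  have h0 : ∀ i : Fin (2 * l + 1), (n : ℤ) ∣ (i : ℕ) - (l : ℤ) → (i : ℕ) = l := by
    intro i hi
    have := Int.eq_zero_of_abs_lt_dvd hi (by rw [abs_lt]; omega)
    omega
  split_ifs with h
  · rw [Finset.card_eq_one]
    refine ⟨⟨l, by omega⟩, ?_⟩
    ext i
    simp only [Finset.mem_filter, Finset.mem_univ, true_and, Finset.mem_singleton]
    constructor
    · rintro ⟨hi, -⟩
      exact Fin.ext (h0 i hi)
    · rintro rfl
      refine ⟨by simp, Or.inr ⟨Fin.ext ?_, h⟩⟩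
      rw [Fin.val_rev]
      simp only
      omega
  · rw [Finset.card_eq_zero, Finset.filter_eq_empty_iff]
    rintro i - ⟨hi, h1 | ⟨-, h1⟩⟩
    · have := h0 i hi
      rw [Fin.val_rev] at h1
      omega
    · exact h h1

theorem V_eq_D_two : V = D 2 := by
  have : R 2 = A₁ := by
    apply Subtype.ext
    ext i j
    fin_cases i <;> fin_cases j <;> simp [R, A₁]
  rw [V, D, this, Set.pair_comm]

theorem finrank_invVec_V (l : ℕ) (hl : l ≤ 6) : Module.finrank ℂ (invVec V (2 * l)) =
    [1, 0, 2, 1, 3, 2, 4].getD l 0 := by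
  rw [V_eq_D_two, finrank_invVec_dihedral (by decide) (by decide)]
  interval_cases l <;> decide

theorem finrank_invVec_D_four (l : ℕ) (hl : l ≤ 6) : Module.finrank ℂ (invVec (D 4) (2 * l)) =
    [1, 0, 1, 0, 2, 1, 2].getD l 0 := by
  rw [finrank_invVec_dihedral (by decide) (by decide)]
  interval_cases l <;> decide

theorem finrank_invVec_D_six (l : ℕ) (hl : l ≤ 6) : Module.finrank ℂ (invVec (D 6) (2 * l)) =
    [1, 0, 1, 0, 1, 0, 2].getD l 0 := by
  rw [finrank_invVec_dihedral (by decide) (by decide)]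
  interval_cases l <;> decide

/-! ### Binary quadratics transforming as vectors of `ℝ³` -/

/-- Three binary quadratics with `∑ Qⱼ² = 0` that transform under `SU(2)` as the coordinates
of `ℝ³` transform under `SO(3)`. -/
def quadr (s t : ℂ) : Fin 3 → ℂ :=
  ![-2 * Complex.I * s * t, -(s ^ 2 + t ^ 2), Complex.I * (s ^ 2 - t ^ 2)]

theorem quadr_subst (a : SU2) {g : SO3} (h : cover3 a = g) (s t : ℂ) (j : Fin 3) :
    quadr ((a : Matrix (Fin 2) (Fin 2) ℂ) 0 0 * s + (a : Matrix (Fin 2) (Fin 2) ℂ) 0 1 * t)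
      ((a : Matrix (Fin 2) (Fin 2) ℂ) 1 0 * s + (a : Matrix (Fin 2) (Fin 2) ℂ) 1 1 * t) j =
      ∑ i, (((g : Matrix (Fin 3) (Fin 3) ℝ) j i : ℝ) : ℂ) * quadr s t i := by
  obtain ⟨u, hu, -⟩ := exists_quatMat a
  have hg : (g : Matrix (Fin 3) (Fin 3) ℝ) = rotMat (quatMat u) := by rw [← h, ← hu]; rfl
  have hI := Complex.I_sq
  rw [hg, hu, rotMat_quatMat]
  fin_cases j <;> simp [quadr, quatMat, Fin.sum_univ_succ] <;> grind

/-- The functions given by binary forms of degree `k`. -/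
def formSpace (k : ℕ) : Submodule ℂ (ℂ × ℂ → ℂ) :=
  Submodule.span ℂ {f | ∃ i j, i + j = k ∧ f = fun z => z.1 ^ i * z.2 ^ j}

theorem exists_binForm_eq {k : ℕ} {f : ℂ × ℂ → ℂ} (hf : f ∈ formSpace k) :
    ∃ v : Fin (k + 1) → ℂ, ∀ s t, binForm v s t = f (s, t) := by
  induction hf using Submodule.span_induction with
  | mem f hf =>
    obtain ⟨i, j, hij, rfl⟩ := hf
    refine ⟨Pi.single ⟨i, by omega⟩ 1, fun s t => ?_⟩
    simp only [binForm, Pi.single_apply, ite_mul, one_mul, zero_mul, Finset.sum_ite_eq',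
      Finset.mem_univ, if_true]
    rw [show k - i = j by omega]
  | zero => exact ⟨0, fun s t => by simp [binForm]⟩
  | add f g _ _ hf hg =>
    obtain ⟨v, hv⟩ := hf
    obtain ⟨w, hw⟩ := hg
    exact ⟨v + w, fun s t => by
      rw [Pi.add_apply, ← hv, ← hw]
      simp [binForm, add_mul, Finset.sum_add_distrib]⟩
  | smul c f _ hf =>
    obtain ⟨v, hv⟩ := hf
    exact ⟨c • v, fun s t => by
      rw [Pi.smul_apply, ← hv]
      simp [binForm, Finset.mul_sum, mul_assoc]⟩

theorem formSpace_mul {k l : ℕ} {f g : ℂ × ℂ → ℂ} (hf : f ∈ formSpace k) (hg : g ∈ formSpace l) :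
    f * g ∈ formSpace (k + l) := by
  have h := Submodule.mul_mem_mul hf hg
  rw [formSpace, formSpace, Submodule.span_mul_span] at h
  refine Submodule.span_mono ?_ h
  rintro _ ⟨_, ⟨i, j, hij, rfl⟩, _, ⟨i', j', hij', rfl⟩, rfl⟩
  refine ⟨i + i', j + j', by omega, ?_⟩
  funext z
  simp only [Pi.mul_apply]
  ring

theorem formSpace_pow {k : ℕ} {f : ℂ × ℂ → ℂ} (hf : f ∈ formSpace k) (n : ℕ) :
    f ^ n ∈ formSpace (n * k) := by
  induction n with
  | zero =>
    exact Submodule.subset_span ⟨0, 0, by simp, by funext z; simp⟩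
  | succ n ih =>
    rw [pow_succ, Nat.succ_mul]
    exact formSpace_mul ih hf

theorem quadr_mem (j : Fin 3) : (fun z : ℂ × ℂ => quadr z.1 z.2 j) ∈ formSpace 2 := by
  have hm : ∀ i j, i + j = 2 → (fun z : ℂ × ℂ => z.1 ^ i * z.2 ^ j) ∈ formSpace 2 :=
    fun i j h => Submodule.subset_span ⟨i, j, h, rfl⟩
  have h0 := hm 2 0 rfl
  have h1 := hm 1 1 rfl
  have h2 := hm 0 2 rfl
  fin_cases j
  · convert! (formSpace 2).smul_mem (-2 * Complex.I) h1 using 1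
    funext z; simp [quadr]; ring
  · convert! (formSpace 2).neg_mem ((formSpace 2).add_mem h0 h2) using 1
    funext z; simp [quadr]
  · convert! (formSpace 2).smul_mem Complex.I ((formSpace 2).sub_mem h0 h2) using 1
    funext z; simp [quadr]

/-! ### A basis of the invariants of the Klein four group -/

/-- A primitive cube root of unity. -/
def cubeRoot : ℂ := Complex.exp (2 * Real.pi * Complex.I / 3)

theorem cubeRoot_isPrimitiveRoot : IsPrimitiveRoot cubeRoot 3 := by
  have := Complex.isPrimitiveRoot_exp 3 (by norm_num)
  simpa [cubeRoot] using this

theorem cubeRoot_pow_three : cubeRoot ^ 3 = 1 := cubeRoot_isPrimitiveRoot.pow_eq_one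

theorem cubeRoot_sq : cubeRoot ^ 2 = -1 - cubeRoot := by
  have := cubeRoot_isPrimitiveRoot.geom_sum_eq_zero (by norm_num)
  simp [Finset.sum_range_succ] at this
  linear_combination this

/-- The eigenform `Q₁² + ω Q₂² + ω² Q₃²` of the tetrahedral group. -/
def eigPlus (q : Fin 3 → ℂ) : ℂ := q 0 ^ 2 + cubeRoot * q 1 ^ 2 + cubeRoot ^ 2 * q 2 ^ 2

/-- The eigenform `Q₁² + ω² Q₂² + ω Q₃²` of the tetrahedral group. -/
def eigMinus (q : Fin 3 → ℂ) : ℂ := q 0 ^ 2 + cubeRoot ^ 2 * q 1 ^ 2 + cubeRoot * q 2 ^ 2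

/-- The product `Q₁ Q₂ Q₃`. -/
def prodAxes (q : Fin 3 → ℂ) : ℂ := q 0 * q 1 * q 2

theorem eigPlus_mem : (fun z : ℂ × ℂ => eigPlus (quadr z.1 z.2)) ∈ formSpace 4 :=
  add_mem (add_mem (formSpace_pow (quadr_mem 0) 2)
    (Submodule.smul_mem _ cubeRoot (formSpace_pow (quadr_mem 1) 2)))
    (Submodule.smul_mem _ (cubeRoot ^ 2) (formSpace_pow (quadr_mem 2) 2))

theorem eigMinus_mem : (fun z : ℂ × ℂ => eigMinus (quadr z.1 z.2)) ∈ formSpace 4 :=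
  add_mem (add_mem (formSpace_pow (quadr_mem 0) 2)
    (Submodule.smul_mem _ (cubeRoot ^ 2) (formSpace_pow (quadr_mem 1) 2)))
    (Submodule.smul_mem _ cubeRoot (formSpace_pow (quadr_mem 2) 2))

theorem prodAxes_mem : (fun z : ℂ × ℂ => prodAxes (quadr z.1 z.2)) ∈ formSpace 6 := by
  have := formSpace_mul (formSpace_mul (quadr_mem 0) (quadr_mem 1)) (quadr_mem 2)
  exact this

/-- The form `t ^ c u ^ i ū ^ (j - i)`, where `t` is the product of the three quadratics and
`u`, `ū` are the two eigenforms of degree two in the quadratics. -/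
def kleinForm (c j : ℕ) (i : Fin (j + 1)) (q : Fin 3 → ℂ) : ℂ :=
  prodAxes q ^ c * (eigPlus q ^ (i : ℕ) * eigMinus q ^ (j - i))

theorem exists_kleinBasis (c j : ℕ) :
    ∃ E : Matrix (Fin (j + 1)) (Fin (2 * (3 * c + 2 * j) + 1)) ℂ,
      ∀ i s t, binForm (E i) s t = kleinForm c j i (quadr s t) := by
  have h : ∀ i : Fin (j + 1), (fun z : ℂ × ℂ => kleinForm c j i (quadr z.1 z.2)) ∈
      formSpace (2 * (3 * c + 2 * j)) := by
    intro i
    have := formSpace_mul (formSpace_pow prodAxes_mem c)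
      (formSpace_mul (formSpace_pow eigPlus_mem i) (formSpace_pow eigMinus_mem (j - i)))
    rwa [show c * 6 + ((i : ℕ) * 4 + (j - i) * 4) = 2 * (3 * c + 2 * j) by omega] at this
  choose E hE using fun i => exists_binForm_eq (h i)
  exact ⟨E, hE⟩

/-- The matrix whose rows are the coefficient vectors of the forms `kleinForm c j i`. -/
def kleinBasis (c j : ℕ) : Matrix (Fin (j + 1)) (Fin (2 * (3 * c + 2 * j) + 1)) ℂ :=
  (exists_kleinBasis c j).choose

theorem binForm_kleinBasis (c j : ℕ) (i : Fin (j + 1)) (s t : ℂ) :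
    binForm (kleinBasis c j i) s t = kleinForm c j i (quadr s t) :=
  (exists_kleinBasis c j).choose_spec i s t

/-- The eigenforms take any prescribed values. -/
theorem exists_eigPlus_eigMinus (x y : ℂ) :
    ∃ s t, eigPlus (quadr s t) = x ∧ eigMinus (quadr s t) = y := by
  have hI := Complex.I_sq
  have hω := cubeRoot_sq
  have hne : (cubeRoot - cubeRoot ^ 2) ^ 2 = -3 := by
    rw [hω]; linear_combination 4 * hω
  -- In terms of `X = s²`, `Y = t²` one has `u + ū = -12 X Y` and
  -- `u - ū = 2 (ω - ω²) (X² + Y²)`.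
  have hd : cubeRoot - cubeRoot ^ 2 ≠ 0 := by
    intro h; rw [h] at hne; norm_num at hne
  set p : ℂ := -(x + y) / 12
  set r : ℂ := (x - y) / (2 * (cubeRoot - cubeRoot ^ 2)) with hr
  obtain ⟨a, ha⟩ := IsAlgClosed.exists_pow_nat_eq (r + 2 * p) (n := 2) (by norm_num)
  obtain ⟨b, hb⟩ := IsAlgClosed.exists_pow_nat_eq (r - 2 * p) (n := 2) (by norm_num)
  obtain ⟨s, hs⟩ := IsAlgClosed.exists_pow_nat_eq ((a + b) / 2) (n := 2) (by norm_num)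
  obtain ⟨t, ht⟩ := IsAlgClosed.exists_pow_nat_eq ((a - b) / 2) (n := 2) (by norm_num)
  have h1 : s ^ 2 * t ^ 2 = p := by rw [hs, ht]; linear_combination (1 / 4) * ha - (1 / 4) * hb
  have h2 : (s ^ 2) ^ 2 + (t ^ 2) ^ 2 = r := by
    rw [hs, ht]; linear_combination (1 / 2) * ha + (1 / 2) * hb
  have hr' : 2 * (cubeRoot - cubeRoot ^ 2) * r = x - y := by
    rw [hr, mul_div_cancel₀ _ (mul_ne_zero two_ne_zero hd)]
  have e1 : eigPlus (quadr s t) + eigMinus (quadr s t) = x + y := by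
    simp only [eigPlus, eigMinus, quadr, Matrix.cons_val]
    have : -12 * p = x + y := by ring
    rw [← this, ← h1, hω]
    linear_combination (8 * s ^ 2 * t ^ 2 - (s ^ 2 - t ^ 2) ^ 2) * hI
  have e2 : eigPlus (quadr s t) - eigMinus (quadr s t) = x - y := by
    simp only [eigPlus, eigMinus, quadr, Matrix.cons_val]
    rw [← hr', ← h2]
    linear_combination (-(cubeRoot - cubeRoot ^ 2) * (s ^ 2 - t ^ 2) ^ 2) * hI
  exact ⟨s, t, by linear_combination (e1 + e2) / 2, by linear_combination (e1 - e2) / 2⟩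

theorem eig_cube_add (s t : ℂ) :
    eigPlus (quadr s t) ^ 3 + eigMinus (quadr s t) ^ 3 = 27 * prodAxes (quadr s t) ^ 2 := by
  have hI := Complex.I_sq
  have h0 : quadr s t 0 ^ 2 + quadr s t 1 ^ 2 + quadr s t 2 ^ 2 = 0 := by
    simp [quadr]
    linear_combination (4 * s ^ 2 * t ^ 2 + (s ^ 2 - t ^ 2) ^ 2) * hI
  have hω := cubeRoot_sq
  have h3 := cubeRoot_pow_three
  have e1 : eigPlus (quadr s t) + eigMinus (quadr s t) = 3 * quadr s t 0 ^ 2 := by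
    simp only [eigPlus, eigMinus]
    linear_combination (quadr s t 1 ^ 2 + quadr s t 2 ^ 2) * hω - h0
  have e2 : eigPlus (quadr s t) * eigMinus (quadr s t) = -3 * (quadr s t 0 ^ 2 * quadr s t 1 ^ 2 +
      quadr s t 1 ^ 2 * quadr s t 2 ^ 2 + quadr s t 2 ^ 2 * quadr s t 0 ^ 2) := by
    simp only [eigPlus, eigMinus]
    grind
  simp only [prodAxes]
  grind

theorem kleinBasis_linearIndependent (c j : ℕ) :
    LinearIndependent ℂ (fun i => kleinBasis c j i) := by
  rw [Fintype.linearIndependent_iff]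
  intro g hg
  have h : ∀ s t, ∑ i, g i * kleinForm c j i (quadr s t) = 0 := by
    intro s t
    simp only [← binForm_kleinBasis, binForm, Finset.mul_sum]
    rw [Finset.sum_comm]
    refine Finset.sum_eq_zero fun b _ => ?_
    have := congrFun hg b
    simp only [Finset.sum_apply, Pi.smul_apply, smul_eq_mul, Pi.zero_apply] at this
    simp only [← mul_assoc]
    rw [← Finset.sum_mul, ← Finset.sum_mul, this, zero_mul, zero_mul]
  set P : Polynomial ℂ := ∑ i, Polynomial.C (g i) * Polynomial.X ^ (i : ℕ) with hP
  -- Restricting to `u = n + 2`, `ū = 1`, where `t ≠ 0`, shows that `P` has infinitely many zeros.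
  have hroot : ∀ n : ℕ, P.eval ((n : ℂ) + 2) = 0 := by
    intro n
    obtain ⟨s, t, h1, h2⟩ := exists_eigPlus_eigMinus ((n : ℂ) + 2) 1
    have h3 := eig_cube_add s t
    have h4 : prodAxes (quadr s t) ≠ 0 := by
      intro h4
      rw [h1, h2, h4] at h3
      have : ((n + 2) ^ 3 + 1 : ℕ) = 0 := by
        have : (((n + 2) ^ 3 + 1 : ℕ) : ℂ) = 0 := by push_cast; linear_combination h3
        exact_mod_cast this
      omega
    have h5 := h s t
    simp only [kleinForm, h1, h2, one_pow, mul_one] at h5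
    have h6 : prodAxes (quadr s t) ^ c * P.eval ((n : ℂ) + 2) = 0 := by
      rw [← h5, hP, Polynomial.eval_finsetSum, Finset.mul_sum]
      refine Finset.sum_congr rfl fun i _ => ?_
      simp
      ring
    exact (mul_eq_zero.1 h6).resolve_left (pow_ne_zero _ h4)
  have hP0 : P = 0 := by
    refine Polynomial.eq_zero_of_infinite_isRoot P (Set.infinite_of_injective_forall_mem
      (f := fun n : ℕ => (n : ℂ) + 2) (fun a b hab => ?_) hroot)
    have : (a : ℂ) = b := by simpa using hab
    exact_mod_cast this
  intro i
  have : P.coeff i = g i := by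
    simp [hP, Polynomial.coeff_X_pow, Fin.val_inj]
  rw [← this, hP0, Polynomial.coeff_zero]

/-- If substituting `a` multiplies the forms of the basis by a matrix `Δ`, then `Sym(a)` acts on
the rows of the basis through `Δ`. -/
theorem kleinBasis_mul_symPow {c j : ℕ} (a : SU2) {g : SO3} (hg : cover3 a = g)
    (Δ : Matrix (Fin (j + 1)) (Fin (j + 1)) ℂ)
    (h : ∀ i q, kleinForm c j i (fun l => ∑ n, (((g : Matrix (Fin 3) (Fin 3) ℝ) l n : ℝ) : ℂ) * q n)
      = ∑ i', Δ i i' * kleinForm c j i' q) :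
    kleinBasis c j * symPow (2 * (3 * c + 2 * j)) (a : Matrix (Fin 2) (Fin 2) ℂ) =
      Δ * kleinBasis c j := by
  have : ∀ i, Matrix.vecMul (kleinBasis c j i)
      (symPow (2 * (3 * c + 2 * j)) (a : Matrix (Fin 2) (Fin 2) ℂ)) =
        Matrix.vecMul (Δ i) (kleinBasis c j) := by
    intro i
    rw [vecMul_symPow_eq_iff]
    intro s t
    have hq := funext (quadr_subst a hg s t)
    rw [binForm_kleinBasis, hq, h]
    simp only [← binForm_kleinBasis, binForm, Finset.mul_sum, Matrix.vecMul, dotProduct,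
      Finset.sum_mul, mul_assoc]
    rw [Finset.sum_comm]
  ext i b
  exact congrFun (this i) b

theorem kleinBasis_mul_liftA₁ (c j : ℕ) :
    kleinBasis c j * symPow (2 * (3 * c + 2 * j)) (liftA₁ : Matrix (Fin 2) (Fin 2) ℂ) =
      (1 : Matrix (Fin (j + 1)) (Fin (j + 1)) ℂ) * kleinBasis c j := by
  refine kleinBasis_mul_symPow _ cover3_liftA₁ _ fun i q => ?_
  simp [A₁, Fin.sum_univ_succ, kleinForm, eigPlus, eigMinus, prodAxes, Matrix.one_apply]

theorem kleinBasis_mul_liftA₂ (c j : ℕ) :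
    kleinBasis c j * symPow (2 * (3 * c + 2 * j)) (liftA₂ : Matrix (Fin 2) (Fin 2) ℂ) =
      (1 : Matrix (Fin (j + 1)) (Fin (j + 1)) ℂ) * kleinBasis c j := by
  refine kleinBasis_mul_symPow _ cover3_liftA₂ _ fun i q => ?_
  simp [A₂, Fin.sum_univ_succ, kleinForm, eigPlus, eigMinus, prodAxes, Matrix.one_apply]

/-- The rotation `S` acts on the basis by cube roots of unity. -/
theorem kleinBasis_mul_liftS (c j : ℕ) :
    kleinBasis c j * symPow (2 * (3 * c + 2 * j)) (liftS : Matrix (Fin 2) (Fin 2) ℂ) =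
      Matrix.diagonal (fun i : Fin (j + 1) => cubeRoot ^ ((i : ℕ) + j)) * kleinBasis c j := by
  have h3 := cubeRoot_pow_three
  refine kleinBasis_mul_symPow _ cover3_liftS _ fun i q => ?_
  set q' : Fin 3 → ℂ := fun l => ∑ n, (((S : Matrix (Fin 3) (Fin 3) ℝ) l n : ℝ) : ℂ) * q n
  have h0 : q' 0 = -q 1 ∧ q' 1 = -q 2 ∧ q' 2 = q 0 := by
    simp [q', S, Fin.sum_univ_succ]
  obtain ⟨h0, h1, h2⟩ := h0
  have e1 : eigPlus q' = cubeRoot ^ 2 * eigPlus q := by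
    simp only [eigPlus, h0, h1, h2]
    linear_combination (-q 1 ^ 2 - cubeRoot * q 2 ^ 2) * h3
  have e2 : eigMinus q' = cubeRoot * eigMinus q := by
    simp only [eigMinus, h0, h1, h2]
    linear_combination (-q 1 ^ 2) * h3
  have e3 : prodAxes q' = prodAxes q := by
    simp only [prodAxes, h0, h1, h2]
    ring
  simp only [Matrix.diagonal_apply, ite_mul, zero_mul, Finset.sum_ite_eq, Finset.mem_univ, if_true]
  simp only [kleinForm, e1, e2, e3, mul_pow]
  have : cubeRoot ^ ((i : ℕ) + j) = (cubeRoot ^ 2) ^ (i : ℕ) * cubeRoot ^ (j - i) := by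
    rw [← pow_mul, ← pow_add]; congr 1; omega
  rw [this]
  ring

/-- The quarter turn `R₄` exchanges `u` and `ū` and changes the sign of `t`. -/
theorem kleinBasis_mul_liftR_four (c j : ℕ) :
    kleinBasis c j * symPow (2 * (3 * c + 2 * j)) (liftR 4 : Matrix (Fin 2) (Fin 2) ℂ) =
      Matrix.of (fun i i' : Fin (j + 1) => if i' = Fin.rev i then (-1 : ℂ) ^ c else 0) *
        kleinBasis c j := by
  refine kleinBasis_mul_symPow _ (cover3_liftR 4) _ fun i q => ?_
  set q' : Fin 3 → ℂ := fun l => ∑ n, (((R 4 : Matrix (Fin 3) (Fin 3) ℝ) l n : ℝ) : ℂ) * q n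
  have hpi : 2 * Real.pi / (4 : ℕ) = Real.pi / 2 := by push_cast; ring
  have h0 : q' 0 = q 0 ∧ q' 1 = -q 2 ∧ q' 2 = q 1 := by
    simp only [q', R, hpi, Real.cos_pi_div_two, Real.sin_pi_div_two]
    simp [Fin.sum_univ_succ]
  obtain ⟨h0, h1, h2⟩ := h0
  have e1 : eigPlus q' = eigMinus q := by simp only [eigPlus, eigMinus, h0, h1, h2]; ring
  have e2 : eigMinus q' = eigPlus q := by simp only [eigPlus, eigMinus, h0, h1, h2]; ring
  have e3 : prodAxes q' = -prodAxes q := by simp only [prodAxes, h0, h1, h2]; ring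
  simp only [Matrix.of_apply, ite_mul, zero_mul, Finset.sum_ite_eq', Finset.mem_univ, if_true]
  simp only [kleinForm, e1, e2, e3, Fin.val_rev]
  rw [neg_pow, show j + 1 - ((i : ℕ) + 1) = j - i by omega, show j - (j - (i : ℕ)) = i by omega]
  ring

/-! ### Dimensions for the tetrahedral and octahedral groups -/

theorem A₂_mem_T : A₂ ∈ T := by
  have h1 : A₁ ∈ T := Subgroup.subset_closure (by simp)
  have hS : S ∈ T := Subgroup.subset_closure (by simp)
  have : A₂ = S * S * A₁ * S := by
    apply Subtype.ext
    ext i j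
    fin_cases i <;> fin_cases j <;>
      simp [A₁, A₂, S]
  rw [this]
  exact mul_mem (mul_mem (mul_mem hS hS) h1) hS

theorem V_le_T : V ≤ T := by
  rw [V, Subgroup.closure_le]
  rintro g (rfl | rfl)
  · exact Subgroup.subset_closure (by simp)
  · exact A₂_mem_T

theorem T_le_O : T ≤ O := Subgroup.closure_mono (by
  rintro g (rfl | rfl) <;> simp)

theorem T_le_I : T ≤ I := Subgroup.closure_mono (by
  rintro g (rfl | rfl) <;> simp)

theorem kleinBasis_row_mem (c j : ℕ) (i : Fin (j + 1)) :
    kleinBasis c j i ∈ invVec V (2 * (3 * c + 2 * j)) := by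
  refine mem_invVec_closure (even_two_mul _) ?_
  rintro g (rfl | rfl)
  · exact ⟨_, cover3_liftA₁, congrFun ((kleinBasis_mul_liftA₁ c j).trans (Matrix.one_mul _)) i⟩
  · exact ⟨_, cover3_liftA₂, congrFun ((kleinBasis_mul_liftA₂ c j).trans (Matrix.one_mul _)) i⟩

theorem span_kleinBasis {c j : ℕ}
    (hV : Module.finrank ℂ (invVec V (2 * (3 * c + 2 * j))) = j + 1) :
    Submodule.span ℂ (Set.range fun i => kleinBasis c j i) = invVec V (2 * (3 * c + 2 * j)) := by
  apply Submodule.eq_of_le_of_finrank_eq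
  · rw [Submodule.span_le]
    rintro _ ⟨i, rfl⟩
    exact kleinBasis_row_mem c j i
  · rw [finrank_span_eq_card (kleinBasis_linearIndependent c j), hV, Fintype.card_fin]

theorem vecMul_kleinBasis_injective (c j : ℕ) :
    Function.Injective (Matrix.vecMulLinear (kleinBasis c j)) :=
  Matrix.vecMul_injective_iff.2 (kleinBasis_linearIndependent c j)

theorem vecMul_kleinBasis_fixed_iff {c j : ℕ} {a : SU2}
    {Δ : Matrix (Fin (j + 1)) (Fin (j + 1)) ℂ}
    (ha : kleinBasis c j * symPow (2 * (3 * c + 2 * j)) (a : Matrix (Fin 2) (Fin 2) ℂ) =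
      Δ * kleinBasis c j)
    (x : Fin (j + 1) → ℂ) :
    Matrix.vecMul (Matrix.vecMul x (kleinBasis c j))
        (symPow (2 * (3 * c + 2 * j)) (a : Matrix (Fin 2) (Fin 2) ℂ)) =
      Matrix.vecMul x (kleinBasis c j) ↔ Matrix.vecMul x Δ = x := by
  rw [Matrix.vecMul_vecMul, ha, ← Matrix.vecMul_vecMul]
  exact (vecMul_kleinBasis_injective c j).eq_iff

/-- A subspace of the invariants of `V` has the dimension of its space of coordinates. -/
theorem finrank_eq_of_vecMul_mem_iff {c j : ℕ}
    (hV : Module.finrank ℂ (invVec V (2 * (3 * c + 2 * j))) = j + 1)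
    {W : Submodule ℂ (Fin (2 * (3 * c + 2 * j) + 1) → ℂ)} (hW : W ≤ invVec V _)
    {Z : Submodule ℂ (Fin (j + 1) → ℂ)}
    (h : ∀ x, Matrix.vecMul x (kleinBasis c j) ∈ W ↔ x ∈ Z) :
    Module.finrank ℂ W = Module.finrank ℂ Z := by
  have : W = Z.map (Matrix.vecMulLinear (kleinBasis c j)) := by
    ext v
    constructor
    · intro hv
      have hv' := hW hv
      rw [← span_kleinBasis hV, Submodule.mem_span_range_iff_exists_fun] at hv'
      obtain ⟨x, rfl⟩ := hv'
      have e : ∑ i, x i • kleinBasis c j i = Matrix.vecMul x (kleinBasis c j) := by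
        ext b; simp [Matrix.vecMul, dotProduct]
      rw [e] at hv ⊢
      exact ⟨x, (h x).1 hv, rfl⟩
    · rintro ⟨x, hx, rfl⟩
      exact (h x).2 hx
  rw [this, ← (Submodule.equivMapOfInjective _ (vecMul_kleinBasis_injective c j) _).finrank_eq]

theorem vecMul_diagonal_eq_iff {j : ℕ} (x : Fin (j + 1) → ℂ) :
    Matrix.vecMul x (Matrix.diagonal fun i : Fin (j + 1) => cubeRoot ^ ((i : ℕ) + j)) = x ↔
      ∀ i : Fin (j + 1), ¬ 3 ∣ (i : ℕ) + j → x i = 0 := by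
  rw [funext_iff]
  refine forall_congr' fun i => ?_
  rw [Matrix.vecMul_diagonal, ← cubeRoot_isPrimitiveRoot.pow_eq_one_iff_dvd]
  constructor
  · intro h h1
    by_contra h0
    exact h1 (mul_left_cancel₀ h0 (h.trans (mul_one _).symm))
  · intro h
    by_cases h1 : cubeRoot ^ ((i : ℕ) + j) = 1
    · rw [h1, mul_one]
    · rw [h h1, zero_mul]

theorem neg_one_pow_mul_self (c : ℕ) : ((-1 : ℂ)) ^ c * (-1) ^ c = 1 := by
  rw [← mul_pow]; simp

theorem vecMul_swap_eq_iff {c j : ℕ} (x : Fin (j + 1) → ℂ) :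
    Matrix.vecMul x
        (Matrix.of (fun i i' : Fin (j + 1) => if i' = Fin.rev i then (-1 : ℂ) ^ c else 0))
      = x ↔ ∀ i, x (Fin.rev i) = (-1) ^ c * x i := by
  have hε := neg_one_pow_mul_self c
  rw [funext_iff]
  refine forall_congr' fun i => ?_
  have : Matrix.vecMul x (Matrix.of (fun i i' : Fin (j + 1) =>
      if i' = Fin.rev i then (-1 : ℂ) ^ c else 0)) i = x (Fin.rev i) * (-1) ^ c := by
    simp only [Matrix.vecMul, dotProduct, Matrix.of_apply, eq_comm (a := i), Fin.rev_eq_iff,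
      mul_ite, mul_zero, Finset.sum_ite_eq', Finset.mem_univ, if_true]
  rw [this]
  constructor
  · intro h; rw [← h]; linear_combination (-x (Fin.rev i)) * hε
  · intro h; rw [h]; linear_combination (x i) * hε

theorem vecMul_kleinBasis_mem_T_iff {c j : ℕ} (x : Fin (j + 1) → ℂ) :
    Matrix.vecMul x (kleinBasis c j) ∈ invVec T (2 * (3 * c + 2 * j)) ↔
      x ∈ orbitSpace (fun i : Fin (j + 1) => 3 ∣ (i : ℕ) + j) id 0 := by
  constructor
  · intro h
    have := h liftS (by rw [cover3_liftS]; exact Subgroup.subset_closure (by simp))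
    rw [vecMul_kleinBasis_fixed_iff (kleinBasis_mul_liftS c j), vecMul_diagonal_eq_iff] at this
    exact ⟨this, by simp⟩
  · rintro ⟨h, -⟩
    refine mem_invVec_closure (even_two_mul _) ?_
    rintro g (rfl | rfl)
    · refine ⟨_, cover3_liftA₁, ?_⟩
      rw [vecMul_kleinBasis_fixed_iff (kleinBasis_mul_liftA₁ c j), Matrix.vecMul_one]
    · refine ⟨_, cover3_liftS, ?_⟩
      rwa [vecMul_kleinBasis_fixed_iff (kleinBasis_mul_liftS c j), vecMul_diagonal_eq_iff]

theorem vecMul_kleinBasis_mem_O_iff {c j : ℕ} (x : Fin (j + 1) → ℂ) :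
    Matrix.vecMul x (kleinBasis c j) ∈ invVec O (2 * (3 * c + 2 * j)) ↔
      x ∈ orbitSpace (fun i : Fin (j + 1) => 3 ∣ (i : ℕ) + j) Fin.rev c := by
  constructor
  · intro h
    have h1 := h liftS (by rw [cover3_liftS]; exact Subgroup.subset_closure (by simp))
    have h2 := h (liftR 4) (by rw [cover3_liftR]; exact Subgroup.subset_closure (by simp))
    rw [vecMul_kleinBasis_fixed_iff (kleinBasis_mul_liftS c j), vecMul_diagonal_eq_iff] at h1
    rw [vecMul_kleinBasis_fixed_iff (kleinBasis_mul_liftR_four c j), vecMul_swap_eq_iff] at h2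
    exact ⟨h1, h2⟩
  · rintro ⟨h1, h2⟩
    refine mem_invVec_closure (even_two_mul _) ?_
    rintro g (rfl | rfl | rfl)
    · refine ⟨_, cover3_liftA₁, ?_⟩
      rw [vecMul_kleinBasis_fixed_iff (kleinBasis_mul_liftA₁ c j), Matrix.vecMul_one]
    · refine ⟨_, cover3_liftR 4, ?_⟩
      rwa [vecMul_kleinBasis_fixed_iff (kleinBasis_mul_liftR_four c j), vecMul_swap_eq_iff]
    · refine ⟨_, cover3_liftS, ?_⟩
      rwa [vecMul_kleinBasis_fixed_iff (kleinBasis_mul_liftS c j), vecMul_diagonal_eq_iff]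

theorem finrank_invVec_T_eq_card {c j : ℕ}
    (hV : Module.finrank ℂ (invVec V (2 * (3 * c + 2 * j))) = j + 1) :
    Module.finrank ℂ (invVec T (2 * (3 * c + 2 * j))) =
      (Finset.univ.filter fun i : Fin (j + 1) => 3 ∣ (i : ℕ) + j ∧
        ((i : ℕ) < (id i : Fin (j + 1)) ∨ (id i = i ∧ Even 0))).card := by
  rw [finrank_eq_of_vecMul_mem_iff hV (invVec_mono V_le_T _) vecMul_kleinBasis_mem_T_iff,
    finrank_orbitSpace _ _ _ (fun i : Fin (j + 1) => (i : ℕ)) Fin.val_injective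
      (show Function.Involutive id from fun _ => rfl) fun i hi => hi]

theorem finrank_invVec_O_eq_card {c j : ℕ}
    (hV : Module.finrank ℂ (invVec V (2 * (3 * c + 2 * j))) = j + 1) :
    Module.finrank ℂ (invVec O (2 * (3 * c + 2 * j))) =
      (Finset.univ.filter fun i : Fin (j + 1) => 3 ∣ (i : ℕ) + j ∧
        ((i : ℕ) < Fin.rev i ∨ (Fin.rev i = i ∧ Even c))).card := by
  rw [finrank_eq_of_vecMul_mem_iff hV (invVec_mono (V_le_T.trans T_le_O) _)
    vecMul_kleinBasis_mem_O_iff, finrank_orbitSpace _ _ _ (fun i : Fin (j + 1) => (i : ℕ))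
      Fin.val_injective Fin.rev_rev]
  intro i hi
  rw [Fin.val_rev]
  omega

/-- Every `l ≤ 6` other than `1` is `3 c + 2 j` with `c ≤ 1`, and then the invariants of `V` have
dimension `j + 1`; for `l = 1` even `V` has no invariants. -/
theorem finrank_invVec_T (l : ℕ) (hl : l ≤ 6) : Module.finrank ℂ (invVec T (2 * l)) =
    [1, 0, 0, 1, 1, 0, 2].getD l 0 := by
  interval_cases l
  · exact (finrank_invVec_T_eq_card (c := 0) (j := 0) (finrank_invVec_V 0 (by norm_num))).trans
      (by decide)
  · exact Nat.le_zero.1 ((Submodule.finrank_mono (invVec_mono V_le_T _)).trans_eq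
      (finrank_invVec_V 1 (by norm_num)))
  · exact (finrank_invVec_T_eq_card (c := 0) (j := 1) (finrank_invVec_V 2 (by norm_num))).trans
      (by decide)
  · exact (finrank_invVec_T_eq_card (c := 1) (j := 0) (finrank_invVec_V 3 (by norm_num))).trans
      (by decide)
  · exact (finrank_invVec_T_eq_card (c := 0) (j := 2) (finrank_invVec_V 4 (by norm_num))).trans
      (by decide)
  · exact (finrank_invVec_T_eq_card (c := 1) (j := 1) (finrank_invVec_V 5 (by norm_num))).trans
      (by decide)
  · exact (finrank_invVec_T_eq_card (c := 0) (j := 3) (finrank_invVec_V 6 (by norm_num))).trans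
      (by decide)

theorem finrank_invVec_O (l : ℕ) (hl : l ≤ 6) : Module.finrank ℂ (invVec O (2 * l)) =
    [1, 0, 0, 0, 1, 0, 1].getD l 0 := by
  interval_cases l
  · exact (finrank_invVec_O_eq_card (c := 0) (j := 0) (finrank_invVec_V 0 (by norm_num))).trans
      (by decide)
  · exact Nat.le_zero.1 ((Submodule.finrank_mono (invVec_mono (V_le_T.trans T_le_O) _)).trans_eq
      (finrank_invVec_V 1 (by norm_num)))
  · exact (finrank_invVec_O_eq_card (c := 0) (j := 1) (finrank_invVec_V 2 (by norm_num))).trans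
      (by decide)
  · exact (finrank_invVec_O_eq_card (c := 1) (j := 0) (finrank_invVec_V 3 (by norm_num))).trans
      (by decide)
  · exact (finrank_invVec_O_eq_card (c := 0) (j := 2) (finrank_invVec_V 4 (by norm_num))).trans
      (by decide)
  · exact (finrank_invVec_O_eq_card (c := 1) (j := 1) (finrank_invVec_V 5 (by norm_num))).trans
      (by decide)
  · exact (finrank_invVec_O_eq_card (c := 0) (j := 3) (finrank_invVec_V 6 (by norm_num))).trans
      (by decide)

/-! ### Dimensions for the groups that are not products -/

theorem mem_diag {G : Subgroup SO3} {g : SO3} (hg : g ∈ G) : (g, g) ∈ diag G := ⟨g, hg, rfl⟩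

/-- The group generated by `⟨s⟩ × ⟨s⟩` and the diagonal of `⟨t⟩` may be tested on generators. -/
theorem closure_prod_sup_diag_le {s t : Set SO3} {M : Subgroup (SO3 × SO3)}
    (h1 : ∀ g ∈ s, (g, 1) ∈ M) (h2 : ∀ g ∈ s, (1, g) ∈ M) (h3 : ∀ g ∈ t, (g, g) ∈ M) :
    (Subgroup.closure s).prod (Subgroup.closure s) ⊔ diag (Subgroup.closure t) ≤ M := by
  refine sup_le (Subgroup.prod_le_iff.2 ⟨?_, ?_⟩) ?_
  · rw [Subgroup.map_le_iff_le_comap, Subgroup.closure_le]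
    exact h1
  · rw [Subgroup.map_le_iff_le_comap, Subgroup.closure_le]
    exact h2
  · rw [diag, Subgroup.map_le_iff_le_comap, Subgroup.closure_le]
    exact h3

theorem kleinBasis_mul_one (c j : ℕ) :
    kleinBasis c j * symPow (2 * (3 * c + 2 * j)) ((1 : SU2) : Matrix (Fin 2) (Fin 2) ℂ) =
      (1 : Matrix (Fin (j + 1)) (Fin (j + 1)) ℂ) * kleinBasis c j := by
  rw [Submonoid.coe_one, symPow_one, Matrix.mul_one, Matrix.one_mul]

/-- Stabilisation of `∑ Cᵢⱼ eᵢ ⊗ eⱼ` in terms of the coordinates `C`. -/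
theorem mem_matStabilizer_tensorMap_iff {c j : ℕ} {a b : SU2}
    {Δ Δ' : Matrix (Fin (j + 1)) (Fin (j + 1)) ℂ}
    (ha : kleinBasis c j * symPow (2 * (3 * c + 2 * j)) (a : Matrix (Fin 2) (Fin 2) ℂ) =
      Δ * kleinBasis c j)
    (hb : kleinBasis c j * symPow (2 * (3 * c + 2 * j)) (b : Matrix (Fin 2) (Fin 2) ℂ) =
      Δ' * kleinBasis c j)
    (C : Matrix (Fin (j + 1)) (Fin (j + 1)) ℂ) :
    (a, b) ∈ matStabilizer (tensorMap (kleinBasis c j) (kleinBasis c j) C) ↔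
      Δ.transpose * C * Δ' = C := by
  have hinj := tensorMap_injective (kleinBasis_linearIndependent c j)
    (kleinBasis_linearIndependent c j)
  rw [← hinj.eq_iff]
  have : (symPow (2 * (3 * c + 2 * j)) (a : Matrix (Fin 2) (Fin 2) ℂ)).transpose *
      tensorMap (kleinBasis c j) (kleinBasis c j) C *
        symPow (2 * (3 * c + 2 * j)) (b : Matrix (Fin 2) (Fin 2) ℂ) =
      tensorMap (kleinBasis c j) (kleinBasis c j) (Δ.transpose * C * Δ') := by
    have ha' := congrArg Matrix.transpose ha
    rw [Matrix.transpose_mul, Matrix.transpose_mul] at ha'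
    simp only [tensorMap, LinearMap.coe_mk, AddHom.coe_mk]
    calc _ = ((symPow (2 * (3 * c + 2 * j)) (a : Matrix (Fin 2) (Fin 2) ℂ)).transpose *
          (kleinBasis c j).transpose) * C * (kleinBasis c j *
            symPow (2 * (3 * c + 2 * j)) (b : Matrix (Fin 2) (Fin 2) ℂ)) := by
          simp only [Matrix.mul_assoc]
      _ = _ := by rw [ha', hb]; simp only [Matrix.mul_assoc]
  rw [← this]
  rfl

theorem klein_one_mem_map_matStabilizer {c j : ℕ} (C : Matrix (Fin (j + 1)) (Fin (j + 1)) ℂ)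
    {g : SO3} (hg : g = A₁ ∨ g = A₂) :
    (g, 1) ∈ (matStabilizer (tensorMap (kleinBasis c j) (kleinBasis c j) C)).map
      (cover3.prodMap cover3) := by
  have h1 := kleinBasis_mul_one c j
  rcases hg with rfl | rfl
  · exact ⟨(liftA₁, 1), (mem_matStabilizer_tensorMap_iff (kleinBasis_mul_liftA₁ c j) h1 C).2
      (by simp), Prod.ext cover3_liftA₁ (map_one cover3)⟩
  · exact ⟨(liftA₂, 1), (mem_matStabilizer_tensorMap_iff (kleinBasis_mul_liftA₂ c j) h1 C).2
      (by simp), Prod.ext cover3_liftA₂ (map_one cover3)⟩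

theorem one_klein_mem_map_matStabilizer {c j : ℕ} (C : Matrix (Fin (j + 1)) (Fin (j + 1)) ℂ)
    {g : SO3} (hg : g = A₁ ∨ g = A₂) :
    (1, g) ∈ (matStabilizer (tensorMap (kleinBasis c j) (kleinBasis c j) C)).map
      (cover3.prodMap cover3) := by
  have h1 := kleinBasis_mul_one c j
  rcases hg with rfl | rfl
  · exact ⟨(1, liftA₁), (mem_matStabilizer_tensorMap_iff h1 (kleinBasis_mul_liftA₁ c j) C).2
      (by simp), Prod.ext (map_one cover3) cover3_liftA₁⟩
  · exact ⟨(1, liftA₂), (mem_matStabilizer_tensorMap_iff h1 (kleinBasis_mul_liftA₂ c j) C).2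
      (by simp), Prod.ext (map_one cover3) cover3_liftA₂⟩

theorem A₁_A₁_mem_map_matStabilizer {c j : ℕ} (C : Matrix (Fin (j + 1)) (Fin (j + 1)) ℂ) :
    (A₁, A₁) ∈ (matStabilizer (tensorMap (kleinBasis c j) (kleinBasis c j) C)).map
      (cover3.prodMap cover3) := by
  simpa using mul_mem (klein_one_mem_map_matStabilizer C (Or.inl rfl))
    (one_klein_mem_map_matStabilizer C (Or.inl rfl))

theorem cubeRoot_pow_mul_eq_iff (i j : ℕ) (x : ℂ) :
    cubeRoot ^ i * x * cubeRoot ^ j = x ↔ (¬ 3 ∣ i + j → x = 0) := by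
  rw [← cubeRoot_isPrimitiveRoot.pow_eq_one_iff_dvd, pow_add]
  constructor
  · intro h h1
    by_contra h0
    exact h1 (mul_left_cancel₀ h0 (by linear_combination h))
  · intro h
    by_cases h1 : cubeRoot ^ i * cubeRoot ^ j = 1
    · linear_combination x * h1
    · rw [h h1]; ring

theorem diagonal_mul_mul_diagonal_eq_iff {j : ℕ} (C : Matrix (Fin (j + 1)) (Fin (j + 1)) ℂ) :
    (Matrix.diagonal fun i : Fin (j + 1) => cubeRoot ^ ((i : ℕ) + j)).transpose * C *
      (Matrix.diagonal fun i : Fin (j + 1) => cubeRoot ^ ((i : ℕ) + j)) = C ↔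
      ∀ i i' : Fin (j + 1), ¬ 3 ∣ ((i : ℕ) + j) + ((i' : ℕ) + j) → C i i' = 0 := by
  rw [← Matrix.ext_iff]
  refine forall_congr' fun i => forall_congr' fun i' => ?_
  rw [Matrix.diagonal_transpose, Matrix.mul_diagonal, Matrix.diagonal_mul,
    cubeRoot_pow_mul_eq_iff]

theorem diagonal_mul_eq_iff {j : ℕ} (C : Matrix (Fin (j + 1)) (Fin (j + 1)) ℂ) :
    (Matrix.diagonal fun i : Fin (j + 1) => cubeRoot ^ ((i : ℕ) + j)).transpose * C * 1 = C ↔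
      ∀ i i' : Fin (j + 1), ¬ 3 ∣ (i : ℕ) + j → C i i' = 0 := by
  rw [← Matrix.ext_iff]
  refine forall_congr' fun i => forall_congr' fun i' => ?_
  rw [Matrix.diagonal_transpose, mul_one, Matrix.diagonal_mul]
  simpa using cubeRoot_pow_mul_eq_iff ((i : ℕ) + j) 0 (C i i')

theorem mul_diagonal_eq_iff {j : ℕ} (C : Matrix (Fin (j + 1)) (Fin (j + 1)) ℂ) :
    (1 : Matrix (Fin (j + 1)) (Fin (j + 1)) ℂ).transpose * C *
      (Matrix.diagonal fun i : Fin (j + 1) => cubeRoot ^ ((i : ℕ) + j)) = C ↔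
      ∀ i i' : Fin (j + 1), ¬ 3 ∣ (i' : ℕ) + j → C i i' = 0 := by
  rw [← Matrix.ext_iff]
  refine forall_congr' fun i => forall_congr' fun i' => ?_
  rw [Matrix.transpose_one, one_mul, Matrix.mul_diagonal]
  simpa using cubeRoot_pow_mul_eq_iff 0 ((i' : ℕ) + j) (C i i')

theorem swap_mul_mul_swap_eq_iff {c j : ℕ} (C : Matrix (Fin (j + 1)) (Fin (j + 1)) ℂ) :
    (Matrix.of (fun i i' : Fin (j + 1) => if i' = Fin.rev i then (-1 : ℂ) ^ c else 0)).transpose *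
      C * (Matrix.of (fun i i' : Fin (j + 1) => if i' = Fin.rev i then (-1 : ℂ) ^ c else 0)) = C ↔
      ∀ i i', C (Fin.rev i) (Fin.rev i') = C i i' := by
  have hε := neg_one_pow_mul_self c
  rw [← Matrix.ext_iff]
  refine forall_congr' fun i => forall_congr' fun i' => ?_
  have : ((Matrix.of (fun i i' : Fin (j + 1) => if i' = Fin.rev i then (-1 : ℂ) ^ c else
      0)).transpose * C * (Matrix.of (fun i i' : Fin (j + 1) =>
        if i' = Fin.rev i then (-1 : ℂ) ^ c else 0))) i i' = C (Fin.rev i) (Fin.rev i') := by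
    simp only [Matrix.mul_apply, Matrix.transpose_apply, Matrix.of_apply, eq_comm (a := i),
      eq_comm (a := i'), Fin.rev_eq_iff, mul_ite, ite_mul, mul_zero, zero_mul, Finset.sum_ite_eq',
      Finset.mem_univ, if_true]
    linear_combination (C (Fin.rev i) (Fin.rev i')) * hε
  rw [this]

/-- A space of matrices invariant under `V × V` has the dimension of its space of coordinates. -/
theorem finrank_invMat_of_tensorMap_mem_iff {c j : ℕ}
    (hV : Module.finrank ℂ (invVec V (2 * (3 * c + 2 * j))) = j + 1)
    {K : Subgroup (SO3 × SO3)} (hK : V.prod V ≤ K)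
    {Z : Submodule ℂ (Fin (j + 1) × Fin (j + 1) → ℂ)}
    (h : ∀ C : Matrix (Fin (j + 1)) (Fin (j + 1)) ℂ,
      tensorMap (kleinBasis c j) (kleinBasis c j) C ∈ invMat K _ ↔
        (fun x : Fin (j + 1) × Fin (j + 1) => C x.1 x.2) ∈ Z) :
    Module.finrank ℂ (invMat K (2 * (3 * c + 2 * j))) = Module.finrank ℂ Z := by
  have hspan := span_kleinBasis hV
  have hli := kleinBasis_linearIndependent c j
  let L : (Fin (j + 1) × Fin (j + 1) → ℂ) →ₗ[ℂ] Matrix _ _ ℂ :=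
    (tensorMap (kleinBasis c j) (kleinBasis c j)).comp
      (LinearEquiv.curry ℂ ℂ (Fin (j + 1)) (Fin (j + 1))).toLinearMap
  have hL : Function.Injective L :=
    (tensorMap_injective hli hli).comp (LinearEquiv.curry ℂ ℂ _ _).injective
  have : invMat K (2 * (3 * c + 2 * j)) = Z.map L := by
    ext N
    constructor
    · intro hN
      have hN' := invMat_mono hK _ hN
      rw [invMat_prod_eq_range hspan hli hspan] at hN'
      obtain ⟨C, rfl⟩ := hN'
      exact ⟨_, (h C).1 hN, rfl⟩
    · rintro ⟨x, hx, rfl⟩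
      exact (h (Matrix.of fun i i' => x (i, i'))).2 hx
  rw [this, ← (Submodule.equivMapOfInjective _ hL _).finrank_eq]

theorem tensorMap_mem_TT'_iff {c j : ℕ} (C : Matrix (Fin (j + 1)) (Fin (j + 1)) ℂ) :
    tensorMap (kleinBasis c j) (kleinBasis c j) C ∈
        invMat (V.prod V ⊔ diag T) (2 * (3 * c + 2 * j)) ↔
      (fun x : Fin (j + 1) × Fin (j + 1) => C x.1 x.2) ∈
        orbitSpace (fun x : Fin (j + 1) × Fin (j + 1) => 3 ∣ ((x.1 : ℕ) + j) + ((x.2 : ℕ) + j))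
          id 0 := by
  have hS := kleinBasis_mul_liftS c j
  constructor
  · intro h
    have := h liftS liftS (by
      rw [cover3_liftS]
      exact (le_sup_right : diag T ≤ _) (mem_diag (Subgroup.subset_closure (by simp))))
    have := (diagonal_mul_mul_diagonal_eq_iff C).1
      ((mem_matStabilizer_tensorMap_iff hS hS C).1 this)
    exact ⟨fun x hx => this _ _ hx, by simp⟩
  · rintro ⟨h, -⟩
    refine mem_invMat_of_le (even_two_mul _) (closure_prod_sup_diag_le ?_ ?_ ?_)
    · exact fun g hg => klein_one_mem_map_matStabilizer C hg
    · exact fun g hg => one_klein_mem_map_matStabilizer C hg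
    · rintro g (rfl | rfl)
      · exact A₁_A₁_mem_map_matStabilizer C
      · exact ⟨(liftS, liftS), (mem_matStabilizer_tensorMap_iff hS hS C).2
          ((diagonal_mul_mul_diagonal_eq_iff C).2 fun i i' hi => h (i, i') hi),
          Prod.ext cover3_liftS cover3_liftS⟩

theorem tensorMap_mem_OO'_iff {c j : ℕ} (C : Matrix (Fin (j + 1)) (Fin (j + 1)) ℂ) :
    tensorMap (kleinBasis c j) (kleinBasis c j) C ∈
        invMat (V.prod V ⊔ diag O) (2 * (3 * c + 2 * j)) ↔
      (fun x : Fin (j + 1) × Fin (j + 1) => C x.1 x.2) ∈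
        orbitSpace (fun x : Fin (j + 1) × Fin (j + 1) => 3 ∣ ((x.1 : ℕ) + j) + ((x.2 : ℕ) + j))
          (Prod.map Fin.rev Fin.rev) 0 := by
  have hS := kleinBasis_mul_liftS c j
  have hR := kleinBasis_mul_liftR_four c j
  constructor
  · intro h
    have hs := h liftS liftS (by
      rw [cover3_liftS]
      exact (le_sup_right : diag O ≤ _) (mem_diag (Subgroup.subset_closure (by simp))))
    have hr := h (liftR 4) (liftR 4) (by
      rw [cover3_liftR]
      exact (le_sup_right : diag O ≤ _) (mem_diag (Subgroup.subset_closure (by simp))))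
    have hs' := (diagonal_mul_mul_diagonal_eq_iff C).1
      ((mem_matStabilizer_tensorMap_iff hS hS C).1 hs)
    have hr' := (swap_mul_mul_swap_eq_iff C).1 ((mem_matStabilizer_tensorMap_iff hR hR C).1 hr)
    exact ⟨fun x hx => hs' _ _ hx, fun x => by simpa using hr' x.1 x.2⟩
  · rintro ⟨hs, hr⟩
    refine mem_invMat_of_le (even_two_mul _) (closure_prod_sup_diag_le ?_ ?_ ?_)
    · exact fun g hg => klein_one_mem_map_matStabilizer C hg
    · exact fun g hg => one_klein_mem_map_matStabilizer C hg
    · rintro g (rfl | rfl | rfl)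
      · exact A₁_A₁_mem_map_matStabilizer C
      · exact ⟨(liftR 4, liftR 4), (mem_matStabilizer_tensorMap_iff hR hR C).2
          ((swap_mul_mul_swap_eq_iff C).2 fun i i' => by simpa using hr (i, i')),
          Prod.ext (cover3_liftR 4) (cover3_liftR 4)⟩
      · exact ⟨(liftS, liftS), (mem_matStabilizer_tensorMap_iff hS hS C).2
          ((diagonal_mul_mul_diagonal_eq_iff C).2 fun i i' hi => hs (i, i') hi),
          Prod.ext cover3_liftS cover3_liftS⟩

theorem tensorMap_mem_OO''_iff {c j : ℕ} (C : Matrix (Fin (j + 1)) (Fin (j + 1)) ℂ) :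
    tensorMap (kleinBasis c j) (kleinBasis c j) C ∈
        invMat (T.prod T ⊔ diag O) (2 * (3 * c + 2 * j)) ↔
      (fun x : Fin (j + 1) × Fin (j + 1) => C x.1 x.2) ∈
        orbitSpace (fun x : Fin (j + 1) × Fin (j + 1) => 3 ∣ (x.1 : ℕ) + j ∧ 3 ∣ (x.2 : ℕ) + j)
          (Prod.map Fin.rev Fin.rev) 0 := by
  have hS := kleinBasis_mul_liftS c j
  have hR := kleinBasis_mul_liftR_four c j
  have h1 := kleinBasis_mul_one c j
  have hST : S ∈ T := Subgroup.subset_closure (by simp)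
  constructor
  · intro h
    have hs1 := h liftS 1 (by
      rw [cover3_liftS, map_one]
      exact (le_sup_left : T.prod T ≤ _) ⟨hST, one_mem T⟩)
    have hs2 := h 1 liftS (by
      rw [cover3_liftS, map_one]
      exact (le_sup_left : T.prod T ≤ _) ⟨one_mem T, hST⟩)
    have hr := h (liftR 4) (liftR 4) (by
      rw [cover3_liftR]
      exact (le_sup_right : diag O ≤ _) (mem_diag (Subgroup.subset_closure (by simp))))
    have hs1' := (diagonal_mul_eq_iff C).1 ((mem_matStabilizer_tensorMap_iff hS h1 C).1 hs1)
    have hs2' := (mul_diagonal_eq_iff C).1 ((mem_matStabilizer_tensorMap_iff h1 hS C).1 hs2)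
    have hr' := (swap_mul_mul_swap_eq_iff C).1 ((mem_matStabilizer_tensorMap_iff hR hR C).1 hr)
    refine ⟨fun x hx => ?_, fun x => by simpa using hr' x.1 x.2⟩
    rcases not_and_or.1 hx with hx | hx
    · exact hs1' _ _ hx
    · exact hs2' _ _ hx
  · rintro ⟨hs, hr⟩
    have hs1 : (liftS, 1) ∈ matStabilizer (tensorMap (kleinBasis c j) (kleinBasis c j) C) :=
      (mem_matStabilizer_tensorMap_iff hS h1 C).2
        ((diagonal_mul_eq_iff C).2 fun i i' hi => hs (i, i') fun h => hi h.1)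
    have hs2 : (1, liftS) ∈ matStabilizer (tensorMap (kleinBasis c j) (kleinBasis c j) C) :=
      (mem_matStabilizer_tensorMap_iff h1 hS C).2
        ((mul_diagonal_eq_iff C).2 fun i i' hi => hs (i, i') fun h => hi h.2)
    refine mem_invMat_of_le (even_two_mul _) (closure_prod_sup_diag_le ?_ ?_ ?_)
    · rintro g (rfl | rfl)
      · exact klein_one_mem_map_matStabilizer C (Or.inl rfl)
      · exact ⟨(liftS, 1), hs1, Prod.ext cover3_liftS (map_one cover3)⟩
    · rintro g (rfl | rfl)
      · exact one_klein_mem_map_matStabilizer C (Or.inl rfl)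
      · exact ⟨(1, liftS), hs2, Prod.ext (map_one cover3) cover3_liftS⟩
    · rintro g (rfl | rfl | rfl)
      · exact A₁_A₁_mem_map_matStabilizer C
      · exact ⟨(liftR 4, liftR 4), (mem_matStabilizer_tensorMap_iff hR hR C).2
          ((swap_mul_mul_swap_eq_iff C).2 fun i i' => by simpa using hr (i, i')),
          Prod.ext (cover3_liftR 4) (cover3_liftR 4)⟩
      · refine ⟨(liftS, liftS), ?_, Prod.ext cover3_liftS cover3_liftS⟩
        simpa using mul_mem hs1 hs2

theorem pairLabel_injective (j : ℕ) :
    Function.Injective fun x : Fin (j + 1) × Fin (j + 1) => (j + 1) * (x.1 : ℕ) + x.2 := by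
  rintro ⟨a, b⟩ ⟨a', b'⟩ h
  have h1 : (finProdFinEquiv (a, b) : ℕ) = finProdFinEquiv (a', b') := by
    simp only [finProdFinEquiv_apply_val]
    simp only at h
    omega
  exact finProdFinEquiv.injective (Fin.ext h1)

theorem finrank_invMat_TT'_eq_card {c j : ℕ}
    (hV : Module.finrank ℂ (invVec V (2 * (3 * c + 2 * j))) = j + 1) :
    Module.finrank ℂ (invMat (V.prod V ⊔ diag T) (2 * (3 * c + 2 * j))) =
      (Finset.univ.filter fun x : Fin (j + 1) × Fin (j + 1) =>
        3 ∣ ((x.1 : ℕ) + j) + ((x.2 : ℕ) + j) ∧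
          ((j + 1) * (x.1 : ℕ) + x.2 < (j + 1) * ((id x).1 : ℕ) + (id x).2 ∨
            (id x = x ∧ Even 0))).card := by
  rw [finrank_invMat_of_tensorMap_mem_iff hV le_sup_left tensorMap_mem_TT'_iff,
    finrank_orbitSpace _ _ _ _ (pairLabel_injective j) (show
      Function.Involutive id from fun _ => rfl) fun _ h => h]

theorem finrank_invMat_OO'_eq_card {c j : ℕ}
    (hV : Module.finrank ℂ (invVec V (2 * (3 * c + 2 * j))) = j + 1) :
    Module.finrank ℂ (invMat (V.prod V ⊔ diag O) (2 * (3 * c + 2 * j))) =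
      (Finset.univ.filter fun x : Fin (j + 1) × Fin (j + 1) =>
        3 ∣ ((x.1 : ℕ) + j) + ((x.2 : ℕ) + j) ∧
          ((j + 1) * (x.1 : ℕ) + x.2 < (j + 1) * (Fin.rev x.1 : ℕ) + Fin.rev x.2 ∨
            (Prod.map Fin.rev Fin.rev x = x ∧ Even 0))).card := by
  rw [finrank_invMat_of_tensorMap_mem_iff hV le_sup_left tensorMap_mem_OO'_iff,
    finrank_orbitSpace _ _ _ _ (pairLabel_injective j) (Fin.rev_involutive.prodMap
      Fin.rev_involutive)]
  · rfl
  · rintro ⟨a, b⟩ h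
    simp only [Prod.map_apply, Fin.val_rev] at h ⊢
    omega

theorem finrank_invMat_OO''_eq_card {c j : ℕ}
    (hV : Module.finrank ℂ (invVec V (2 * (3 * c + 2 * j))) = j + 1) :
    Module.finrank ℂ (invMat (T.prod T ⊔ diag O) (2 * (3 * c + 2 * j))) =
      (Finset.univ.filter fun x : Fin (j + 1) × Fin (j + 1) =>
        (3 ∣ (x.1 : ℕ) + j ∧ 3 ∣ (x.2 : ℕ) + j) ∧
          ((j + 1) * (x.1 : ℕ) + x.2 < (j + 1) * (Fin.rev x.1 : ℕ) + Fin.rev x.2 ∨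
            (Prod.map Fin.rev Fin.rev x = x ∧ Even 0))).card := by
  rw [finrank_invMat_of_tensorMap_mem_iff hV
    ((Subgroup.prod_mono V_le_T V_le_T).trans le_sup_left) tensorMap_mem_OO''_iff,
    finrank_orbitSpace _ _ _ _ (pairLabel_injective j) (Fin.rev_involutive.prodMap
      Fin.rev_involutive)]
  · rfl
  · rintro ⟨a, b⟩ h
    simp only [Prod.map_apply, Fin.val_rev] at h ⊢
    omega

theorem finrank_invMat_one_of_V_le {K : Subgroup (SO3 × SO3)} (hK : V.prod V ≤ K) :
    Module.finrank ℂ (invMat K (2 * 1)) = 0 := by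
  refine Nat.le_zero.1 ((Submodule.finrank_mono (invMat_mono hK _)).trans_eq ?_)
  rw [finrank_invMat_prod, finrank_invVec_V 1 (by norm_num)]
  rfl

theorem finrank_invMat_TT' (l : ℕ) (hl : l ≤ 6) :
    Module.finrank ℂ (invMat (V.prod V ⊔ diag T) (2 * l)) = [1, 0, 2, 1, 3, 2, 6].getD l 0 := by
  interval_cases l
  · exact (finrank_invMat_TT'_eq_card (c := 0) (j := 0) (finrank_invVec_V 0 (by norm_num))).trans
      (by decide)
  · exact finrank_invMat_one_of_V_le le_sup_left
  · exact (finrank_invMat_TT'_eq_card (c := 0) (j := 1) (finrank_invVec_V 2 (by norm_num))).trans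
      (by decide)
  · exact (finrank_invMat_TT'_eq_card (c := 1) (j := 0) (finrank_invVec_V 3 (by norm_num))).trans
      (by decide)
  · exact (finrank_invMat_TT'_eq_card (c := 0) (j := 2) (finrank_invVec_V 4 (by norm_num))).trans
      (by decide)
  · exact (finrank_invMat_TT'_eq_card (c := 1) (j := 1) (finrank_invVec_V 5 (by norm_num))).trans
      (by decide)
  · exact (finrank_invMat_TT'_eq_card (c := 0) (j := 3) (finrank_invVec_V 6 (by norm_num))).trans
      (by decide)

theorem finrank_invMat_OO' (l : ℕ) (hl : l ≤ 6) :
    Module.finrank ℂ (invMat (V.prod V ⊔ diag O) (2 * l)) = [1, 0, 1, 1, 2, 1, 3].getD l 0 := by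
  interval_cases l
  · exact (finrank_invMat_OO'_eq_card (c := 0) (j := 0) (finrank_invVec_V 0 (by norm_num))).trans
      (by decide)
  · exact finrank_invMat_one_of_V_le le_sup_left
  · exact (finrank_invMat_OO'_eq_card (c := 0) (j := 1) (finrank_invVec_V 2 (by norm_num))).trans
      (by decide)
  · exact (finrank_invMat_OO'_eq_card (c := 1) (j := 0) (finrank_invVec_V 3 (by norm_num))).trans
      (by decide)
  · exact (finrank_invMat_OO'_eq_card (c := 0) (j := 2) (finrank_invVec_V 4 (by norm_num))).trans
      (by decide)
  · exact (finrank_invMat_OO'_eq_card (c := 1) (j := 1) (finrank_invVec_V 5 (by norm_num))).trans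
      (by decide)
  · exact (finrank_invMat_OO'_eq_card (c := 0) (j := 3) (finrank_invVec_V 6 (by norm_num))).trans
      (by decide)

theorem finrank_invMat_OO'' (l : ℕ) (hl : l ≤ 6) :
    Module.finrank ℂ (invMat (T.prod T ⊔ diag O) (2 * l)) = [1, 0, 0, 1, 1, 0, 2].getD l 0 := by
  interval_cases l
  · exact (finrank_invMat_OO''_eq_card (c := 0) (j := 0) (finrank_invVec_V 0 (by norm_num))).trans
      (by decide)
  · exact finrank_invMat_one_of_V_le ((Subgroup.prod_mono V_le_T V_le_T).trans le_sup_left)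
  · exact (finrank_invMat_OO''_eq_card (c := 0) (j := 1) (finrank_invVec_V 2 (by norm_num))).trans
      (by decide)
  · exact (finrank_invMat_OO''_eq_card (c := 1) (j := 0) (finrank_invVec_V 3 (by norm_num))).trans
      (by decide)
  · exact (finrank_invMat_OO''_eq_card (c := 0) (j := 2) (finrank_invVec_V 4 (by norm_num))).trans
      (by decide)
  · exact (finrank_invMat_OO''_eq_card (c := 1) (j := 1) (finrank_invVec_V 5 (by norm_num))).trans
      (by decide)
  · exact (finrank_invMat_OO''_eq_card (c := 0) (j := 3) (finrank_invVec_V 6 (by norm_num))).trans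
      (by decide)

/-! ### Dimensions for the icosahedral group -/

/-- The action of `g` on `ℂ³`. -/
def rotate (g : SO3) (q : Fin 3 → ℂ) : Fin 3 → ℂ :=
  fun l => ∑ n, (((g : Matrix (Fin 3) (Fin 3) ℝ) l n : ℝ) : ℂ) * q n

theorem mem_invVec_closure_of_form {l : ℕ} {v : Fin (2 * l + 1) → ℂ} {F : (Fin 3 → ℂ) → ℂ}
    (hF : ∀ s t, binForm v s t = F (quadr s t)) {gens : Set SO3}
    (h : ∀ g ∈ gens, ∃ a : SU2, cover3 a = g ∧ ∀ q, F (rotate g q) = F q) :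
    v ∈ invVec (Subgroup.closure gens) (2 * l) := by
  refine mem_invVec_closure (even_two_mul l) fun g hg => ?_
  obtain ⟨a, ha, hinv⟩ := h g hg
  refine ⟨a, ha, ?_⟩
  rw [vecMul_symPow_eq_iff]
  intro s t
  rw [hF, hF, ← hinv (quadr s t)]
  exact congrArg F (funext (quadr_subst a ha s t))

theorem form_rotate_of_mem_invVec {k : ℕ} {v : Fin (k + 1) → ℂ} {F : (Fin 3 → ℂ) → ℂ}
    (hF : ∀ s t, binForm v s t = F (quadr s t)) {G : Subgroup SO3} (hv : v ∈ invVec G k)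
    {a : SU2} {g : SO3} (ha : cover3 a = g) (hg : g ∈ G) (s t : ℂ) :
    F (rotate g (quadr s t)) = F (quadr s t) := by
  have := vecMul_symPow_eq_iff.1 (hv a (ha ▸ hg)) s t
  rw [hF, hF] at this
  rw [← this]
  exact congrArg F (funext (quadr_subst a ha s t)).symm

theorem rotate_A₁ (q : Fin 3 → ℂ) : rotate A₁ q = ![q 0, -q 1, -q 2] := by
  funext l
  fin_cases l <;> simp [rotate, A₁, Fin.sum_univ_succ]

theorem rotate_S (q : Fin 3 → ℂ) : rotate S q = ![-q 1, -q 2, q 0] := by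
  funext l
  fin_cases l <;> simp [rotate, S, Fin.sum_univ_succ]

theorem rotate_U (q : Fin 3 → ℂ) : rotate U q =
    ![(((Real.goldenRatio : ℂ) - 1) * q 0 - Real.goldenRatio * q 1 + q 2) / 2,
      (Real.goldenRatio * q 0 + q 1 + ((Real.goldenRatio : ℂ) - 1) * q 2) / 2,
      (-q 0 + ((Real.goldenRatio : ℂ) - 1) * q 1 + Real.goldenRatio * q 2) / 2] := by
  funext l
  fin_cases l <;> simp [rotate, U, Fin.sum_univ_succ] <;> ring

theorem goldenRatio_sq_complex : (Real.goldenRatio : ℂ) ^ 2 = Real.goldenRatio + 1 := by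
  exact_mod_cast Real.goldenRatio_sq

theorem U_mem_I : U ∈ I := Subgroup.subset_closure (by simp)

theorem rotate_U_quadr_one_zero : rotate U (quadr 1 0) =
    ![((Real.goldenRatio : ℂ) + Complex.I) / 2,
      (-1 + ((Real.goldenRatio : ℂ) - 1) * Complex.I) / 2,
      (1 - (Real.goldenRatio : ℂ) + Real.goldenRatio * Complex.I) / 2] := by
  rw [rotate_U]
  simp [quadr]

/-- The form `t` does not vanish at the image under `U` of a point where it vanishes. -/
theorem prodAxes_rotate_U_ne_zero : prodAxes (rotate U (quadr 1 0)) ≠ 0 := by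
  rw [rotate_U_quadr_one_zero]
  simp only [prodAxes, Matrix.cons_val]
  refine mul_ne_zero (mul_ne_zero ?_ ?_) ?_ <;> intro h
  · have := congrArg Complex.im h
    simp at this
  · have := congrArg Complex.re h
    simp at this
  · have := congrArg Complex.im h
    simp at this
    linarith [Real.sqrt_nonneg 5]

theorem prodAxes_quadr_one_zero : prodAxes (quadr 1 0) = 0 := by simp [prodAxes, quadr]

theorem prodAxes_rotate_A₁ (q : Fin 3 → ℂ) : prodAxes (rotate A₁ q) = prodAxes q := by
  simp [rotate_A₁, prodAxes]

theorem prodAxes_rotate_S (q : Fin 3 → ℂ) : prodAxes (rotate S q) = prodAxes q := by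
  simp [rotate_S, prodAxes]
  ring

/-- The form `u ū` of the tetrahedral group, as a polynomial in the quadratics. -/
theorem eigPlus_mul_eigMinus (q : Fin 3 → ℂ) : eigPlus q * eigMinus q =
    q 0 ^ 4 + q 1 ^ 4 + q 2 ^ 4 - q 0 ^ 2 * q 1 ^ 2 - q 1 ^ 2 * q 2 ^ 2 - q 2 ^ 2 * q 0 ^ 2 := by
  have h2 := cubeRoot_sq
  have h3 := cubeRoot_pow_three
  simp only [eigPlus, eigMinus]
  grind

theorem eigPlus_mul_eigMinus_rotate_U_ne :
    eigPlus (rotate U (quadr 1 0)) * eigMinus (rotate U (quadr 1 0)) ≠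
      eigPlus (quadr 1 0) * eigMinus (quadr 1 0) := by
  have hI := Complex.I_sq
  have hτ := goldenRatio_sq_complex
  have h1 : eigPlus (rotate U (quadr 1 0)) * eigMinus (rotate U (quadr 1 0)) =
      3 / 4 * (-1 + (2 * (Real.goldenRatio : ℂ) - 1) * Complex.I) := by
    rw [eigPlus_mul_eigMinus, rotate_U_quadr_one_zero]
    simp only [Matrix.cons_val]
    grind
  have h2 : eigPlus (quadr 1 0) * eigMinus (quadr 1 0) = 3 := by
    rw [eigPlus_mul_eigMinus]
    simp [quadr]
    grind
  rw [h1, h2]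
  intro h
  have := congrArg Complex.re h
  norm_num at this

/-- The product of the linear forms of the six fivefold axes of the icosahedron. -/
def icosaForm (q : Fin 3 → ℂ) : ℂ :=
  (q 1 ^ 2 - (Real.goldenRatio : ℂ) ^ 2 * q 2 ^ 2) *
    (q 0 ^ 2 - (Real.goldenRatio : ℂ) ^ 2 * q 1 ^ 2) *
      (q 2 ^ 2 - (Real.goldenRatio : ℂ) ^ 2 * q 0 ^ 2)

theorem icosaForm_rotate_U (q : Fin 3 → ℂ) : icosaForm (rotate U q) = icosaForm q := by
  have hτ := goldenRatio_sq_complex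
  rw [rotate_U]
  simp only [icosaForm, Matrix.cons_val]
  set τ := (Real.goldenRatio : ℂ)
  -- The rotation permutes the six linear forms up to sign.
  set x' := ((τ - 1) * q 0 - τ * q 1 + q 2) / 2
  set y' := (τ * q 0 + q 1 + (τ - 1) * q 2) / 2
  set z' := (-q 0 + (τ - 1) * q 1 + τ * q 2) / 2
  have h1 : y' + τ * z' = q 1 + τ * q 2 := by grind
  have h2 : y' - τ * z' = τ * q 0 - q 2 := by grind
  have h3 : x' - τ * y' = -q 0 - τ * q 1 := by grind
  have h4 : x' + τ * y' = τ * q 0 + q 2 := by grind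
  have h5 : z' - τ * x' = -q 0 + τ * q 1 := by grind
  have h6 : z' + τ * x' = -q 1 + τ * q 2 := by grind
  calc (y' ^ 2 - τ ^ 2 * z' ^ 2) * (x' ^ 2 - τ ^ 2 * y' ^ 2) * (z' ^ 2 - τ ^ 2 * x' ^ 2)
      = (y' + τ * z') * (y' - τ * z') * ((x' - τ * y') * (x' + τ * y')) *
          ((z' - τ * x') * (z' + τ * x')) := by ring
    _ = _ := by rw [h1, h2, h3, h4, h5, h6]; ring

theorem icosaForm_mem : (fun z : ℂ × ℂ => icosaForm (quadr z.1 z.2)) ∈ formSpace (2 * 6) := by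
  have h : ∀ i j : Fin 3, (fun z : ℂ × ℂ => quadr z.1 z.2 i ^ 2 -
      (Real.goldenRatio : ℂ) ^ 2 * quadr z.1 z.2 j ^ 2) ∈ formSpace 4 := fun i j =>
    sub_mem (formSpace_pow (quadr_mem i) 2)
      (Submodule.smul_mem _ ((Real.goldenRatio : ℂ) ^ 2) (formSpace_pow (quadr_mem j) 2))
  have := formSpace_mul (formSpace_mul (h 1 2) (h 0 1)) (h 2 0)
  exact this

theorem exists_icosaForm_mem_invVec : ∃ v ∈ invVec I (2 * 6), v ≠ 0 := by
  obtain ⟨v, hv⟩ := exists_binForm_eq icosaForm_mem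
  refine ⟨v, mem_invVec_closure_of_form (F := icosaForm) hv ?_, ?_⟩
  · rintro g (rfl | rfl | rfl)
    · exact ⟨_, cover3_liftA₁, fun q => by simp [rotate_A₁, icosaForm]⟩
    · exact ⟨_, cover3_liftS, fun q => by simp [rotate_S, icosaForm]; ring⟩
    · exact ⟨_, cover3_liftU, icosaForm_rotate_U⟩
  · rintro rfl
    have h := hv 1 0
    have hτ := goldenRatio_sq_complex
    have h' : (Real.goldenRatio : ℂ) + 2 ≠ 0 := by
      have := Real.goldenRatio_pos
      intro h
      have : Real.goldenRatio + 2 = 0 := by exact_mod_cast h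
      linarith
    have h0 : (Real.goldenRatio : ℂ) ≠ 0 := by exact_mod_cast Real.goldenRatio_ne_zero
    -- The left side is the value of the form at `s = 1`, `t = 0`.
    have h1 : (Real.goldenRatio : ℂ) ^ 2 * (Real.goldenRatio + 2) = 0 := by
      have h2 : quadr 1 0 = ![0, -1, Complex.I] := by simp [quadr]
      have hI := Complex.I_sq
      rw [h2] at h
      simp only [binForm, Pi.zero_apply, zero_mul, Finset.sum_const_zero, icosaForm,
        Matrix.cons_val] at h
      grind
    exact (mul_ne_zero (pow_ne_zero 2 h0) h') h1

/-- A tetrahedral invariant that is not fixed by `U` makes the icosahedral invariants smaller. -/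
theorem finrank_invVec_I_lt {l : ℕ} {F : (Fin 3 → ℂ) → ℂ}
    (hF : (fun z : ℂ × ℂ => F (quadr z.1 z.2)) ∈ formSpace (2 * l))
    (hA₁ : ∀ q, F (rotate A₁ q) = F q) (hS : ∀ q, F (rotate S q) = F q)
    (hU : F (rotate U (quadr 1 0)) ≠ F (quadr 1 0)) :
    Module.finrank ℂ (invVec I (2 * l)) < Module.finrank ℂ (invVec T (2 * l)) := by
  obtain ⟨v, hv⟩ := exists_binForm_eq hF
  have hT : v ∈ invVec T (2 * l) := by
    refine mem_invVec_closure_of_form (F := F) hv ?_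
    rintro g (rfl | rfl)
    · exact ⟨_, cover3_liftA₁, hA₁⟩
    · exact ⟨_, cover3_liftS, hS⟩
  refine Submodule.finrank_lt_finrank_of_lt (lt_of_le_of_ne (invVec_mono T_le_I _) fun h => hU ?_)
  exact form_rotate_of_mem_invVec (F := F) hv (h ▸ hT) cover3_liftU U_mem_I 1 0

theorem finrank_invVec_I_le (l : ℕ) :
    Module.finrank ℂ (invVec I (2 * l)) ≤ Module.finrank ℂ (invVec T (2 * l)) :=
  Submodule.finrank_mono (invVec_mono T_le_I _)

/-- The tetrahedral invariants `t`, `u ū` and `t²` are not fixed by `U`, and `icosaForm` is an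
invariant for `l = 6`. -/
theorem finrank_invVec_I (l : ℕ) (hl1 : 1 ≤ l) (hl : l ≤ 6) :
    Module.finrank ℂ (invVec I (2 * l)) = [1, 0, 0, 0, 0, 0, 1].getD l 0 := by
  have hT := finrank_invVec_T l hl
  have hle := finrank_invVec_I_le l
  interval_cases l
  · exact Nat.le_zero.1 (hle.trans_eq hT)
  · exact Nat.le_zero.1 (hle.trans_eq hT)
  · have := finrank_invVec_I_lt (l := 3) (F := prodAxes) prodAxes_mem prodAxes_rotate_A₁
      prodAxes_rotate_S (by
        rw [prodAxes_quadr_one_zero]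
        exact prodAxes_rotate_U_ne_zero)
    exact Nat.lt_one_iff.1 (this.trans_eq hT)
  · have := finrank_invVec_I_lt (l := 4) (F := fun q => eigPlus q * eigMinus q)
      (by
        have := formSpace_mul eigPlus_mem eigMinus_mem
        exact this)
      (fun q => by simp [rotate_A₁, eigPlus, eigMinus])
      (fun q => by simp [rotate_S, eigPlus_mul_eigMinus]; ring)
      eigPlus_mul_eigMinus_rotate_U_ne
    exact Nat.lt_one_iff.1 (this.trans_eq hT)
  · exact Nat.le_zero.1 (hle.trans_eq hT)
  · have hlt := finrank_invVec_I_lt (l := 6) (F := fun q => prodAxes q ^ 2)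
      (formSpace_pow prodAxes_mem 2) (fun q => by simp only [prodAxes_rotate_A₁])
      (fun q => by simp only [prodAxes_rotate_S])
      (by
        rw [prodAxes_quadr_one_zero]
        simpa using prodAxes_rotate_U_ne_zero)
    obtain ⟨v, hv, hv0⟩ := exists_icosaForm_mem_invVec
    have hpos : 0 < Module.finrank ℂ (invVec I (2 * 6)) :=
      Module.finrank_pos_iff_exists_ne_zero.2 ⟨⟨v, hv⟩, fun h => hv0 (congrArg Subtype.val h)⟩
    have h2 : Module.finrank ℂ (invVec I (2 * 6)) < 2 := hlt.trans_eq hT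
    change _ = 1
    omega

/-! ### Assembling the dimensions -/

theorem m_two_mul (K : Subgroup (SO3 × SO3)) (e : ℕ) :
    m (quaternary K) (2 * e) =
      1 + ∑ l ∈ Finset.range e, Module.finrank ℂ (invMat K (2 * (l + 1))) := by
  induction e with
  | zero => simp [m_zero]
  | succ e ih =>
    rw [Nat.mul_succ, m_add_two, ih, Finset.sum_range_succ]
    exact add_assoc _ _ _

theorem dims_quaternary {K : Subgroup (SO3 × SO3)} {f : ℕ → ℕ}
    (h : ∀ l, 1 ≤ l → l ≤ 6 → Module.finrank ℂ (invMat K (2 * l)) = f l) :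
    dims (quaternary K) = [1 + f 1, 1 + f 1 + f 2, 1 + f 1 + f 2 + f 3, 1 + f 1 + f 2 + f 3 + f 4,
      1 + f 1 + f 2 + f 3 + f 4 + f 5, 1 + f 1 + f 2 + f 3 + f 4 + f 5 + f 6] := by
  have hm : ∀ e ≤ 6, m (quaternary K) (2 * e) = 1 + ∑ l ∈ Finset.range e, f (l + 1) := by
    intro e he
    rw [m_two_mul]
    congr 1
    refine Finset.sum_congr rfl fun l hl => h _ (by omega) ?_
    have := Finset.mem_range.1 hl
    omega
  have h1 := hm 1 (by norm_num)
  have h2 := hm 2 (by norm_num)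
  have h3 := hm 3 (by norm_num)
  have h4 := hm 4 (by norm_num)
  have h5 := hm 5 (by norm_num)
  have h6 := hm 6 (by norm_num)
  simp only [Finset.sum_range_succ, Finset.sum_range_zero, zero_add, Nat.reduceAdd, Nat.reduceMul,
    ← add_assoc] at h1 h2 h3 h4 h5 h6
  rw [dims, h1, h2, h3, h4, h5, h6]

theorem dims_bi {G₁ G₂ : Subgroup SO3} {f g : ℕ → ℕ}
    (hf : ∀ l, 1 ≤ l → l ≤ 6 → Module.finrank ℂ (invVec G₁ (2 * l)) = f l)
    (hg : ∀ l, 1 ≤ l → l ≤ 6 → Module.finrank ℂ (invVec G₂ (2 * l)) = g l) :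
    dims (bi G₁ G₂) = [1 + f 1 * g 1, 1 + f 1 * g 1 + f 2 * g 2,
      1 + f 1 * g 1 + f 2 * g 2 + f 3 * g 3, 1 + f 1 * g 1 + f 2 * g 2 + f 3 * g 3 + f 4 * g 4,
      1 + f 1 * g 1 + f 2 * g 2 + f 3 * g 3 + f 4 * g 4 + f 5 * g 5,
      1 + f 1 * g 1 + f 2 * g 2 + f 3 * g 3 + f 4 * g 4 + f 5 * g 5 + f 6 * g 6] :=
  dims_quaternary (f := fun l => f l * g l) fun l h1 h6 => by
    rw [finrank_invMat_prod, hf l h1 h6, hg l h1 h6]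

theorem m_bi_two_mul (G₁ G₂ : Subgroup SO3) (e : ℕ) :
    m (bi G₁ G₂) (2 * e) = 1 + ∑ l ∈ Finset.range e,
      Module.finrank ℂ (invVec G₁ (2 * (l + 1))) * Module.finrank ℂ (invVec G₂ (2 * (l + 1))) := by
  rw [bi, m_two_mul]
  simp only [finrank_invMat_prod]

theorem m_bi_two_mul_eq_of_le {G₁ G₂ : Subgroup SO3} {f g : ℕ → ℕ} {e : ℕ}
    (hf : ∀ l, 1 ≤ l → l ≤ e → Module.finrank ℂ (invVec G₁ (2 * l)) = f l)
    (hg : ∀ l, 1 ≤ l → l ≤ e → Module.finrank ℂ (invVec G₂ (2 * l)) = g l) :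
    m (bi G₁ G₂) (2 * e) = 1 + ∑ l ∈ Finset.range e, f (l + 1) * g (l + 1) := by
  rw [m_bi_two_mul]
  congr 1
  refine Finset.sum_congr rfl fun l hl => ?_
  have := Finset.mem_range.1 hl
  rw [hf _ (by omega) (by omega), hg _ (by omega) (by omega)]

theorem finrank_invVec_D_eight (l : ℕ) (hl : l ≤ 6) : Module.finrank ℂ (invVec (D 8) (2 * l)) =
    if Even l then 1 else 0 :=
  finrank_invVec_dihedral_of_lt (by decide) (by omega)

/-! ### Odd degrees -/

theorem neg_mem_H : ∃ g ∈ H, (g : Matrix (Fin 4) (Fin 4) ℝ) = -1 := by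
  set a : SU2 := unitQuat ![-1, 0, 0, 0] (by simp) with ha
  have h3 : cover3 a = 1 := by
    refine cover3_unitQuat_eq _ ?_
    rw [rotMat_quatMat]
    ext i j
    fin_cases i <;> fin_cases j <;> simp
  refine ⟨cover4 (a, 1), ⟨(a, 1), ⟨?_, ?_⟩, rfl⟩, ?_⟩
  · change cover3 a ∈ V
    rw [h3]; exact one_mem V
  · change cover3 1 ∈ V
    rw [map_one]; exact one_mem V
  · have h1 : (1 : Matrix (Fin 2) (Fin 2) ℂ) = quatMat ![1, 0, 0, 0] := by
      ext i j
      fin_cases i <;> fin_cases j <;> simp [quatMat]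
    change actMat (quatMat ![-1, 0, 0, 0]) 1 = -1
    rw [h1, actMat_quatMat]
    ext i j
    fin_cases i <;> fin_cases j <;> simp [leftMat, rightMat]

/-- A group containing `H` contains `-1`, which changes the sign of every form of odd degree. -/
theorem invariantForms_eq_bot_of_odd {G : Subgroup SO4} (hG : H ≤ G) {d : ℕ} (hd : Odd d) :
    invariantForms G d = ⊥ := by
  rw [eq_bot_iff]
  intro f hf
  obtain ⟨g, hg, hneg⟩ := neg_mem_H
  have hinv := hf.2 g (hG hg)
  have hsub : substHom g f = (-1 : ℂ) ^ d • f := by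
    have h1 : (fun i => ∑ j, MvPolynomial.C (((g : Matrix (Fin 4) (Fin 4) ℝ) i j : ℝ) : ℂ) *
        MvPolynomial.X j) = fun i : Fin 4 => (MvPolynomial.C (-1) * MvPolynomial.X i :
          MvPolynomial (Fin 4) ℂ) := by
      funext i
      rw [hneg]
      rw [Finset.sum_eq_single i (fun j _ hj => by simp [hj.symm]) (by simp)]
      simp
    rw [substHom, h1, MvPolynomial.aeval_def, MvPolynomial.eval₂_eq']
    conv_rhs => rw [f.as_sum, Finset.smul_sum]
    refine Finset.sum_congr rfl fun s hs => ?_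
    have hdeg : ∑ i, s i = d := by
      have := hf.1 (MvPolynomial.mem_support_iff.1 hs)
      rw [← this, Finsupp.weight_apply, Finsupp.sum_fintype _ _ (by simp)]
      simp
    simp only [mul_pow, Finset.prod_mul_distrib, Finset.prod_pow_eq_pow_sum, hdeg]
    rw [MvPolynomial.monomial_eq, Finsupp.prod_fintype _ _ (by simp), MvPolynomial.smul_eq_C_mul,
      MvPolynomial.algebraMap_eq, map_pow]
    ring
  rw [hsub, hd.neg_one_pow, neg_one_smul] at hinv
  rw [Submodule.mem_bot]
  have : (2 : ℂ) • f = 0 := by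
    rw [two_smul]
    nth_rewrite 1 [← hinv]
    exact neg_add_cancel f
  exact (smul_eq_zero.1 this).resolve_left two_ne_zero

end Heisenberg

end

theorem mainTheorem2 :
    -- no invariants in odd degree, for every group containing the Heisenberg group
    (∀ G : Subgroup Heisenberg.SO4, Heisenberg.H ≤ G →
      ∀ d : ℕ, Odd d → Heisenberg.invariantForms G d = ⊥) ∧
    -- the first table
    (Heisenberg.dims (Heisenberg.bi Heisenberg.V Heisenberg.V) = [1, 5, 6, 15, 19, 35] ∧
      Heisenberg.dims (Heisenberg.bi Heisenberg.T Heisenberg.V) = [1, 1, 2, 5, 5, 13] ∧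
      Heisenberg.dims (Heisenberg.bi Heisenberg.T Heisenberg.T) = [1, 1, 2, 3, 3, 7] ∧
      Heisenberg.dims Heisenberg.TT' = [1, 3, 4, 7, 9, 15] ∧
      Heisenberg.dims (Heisenberg.bi Heisenberg.O Heisenberg.V) = [1, 1, 1, 4, 4, 8] ∧
      Heisenberg.dims (Heisenberg.bi Heisenberg.O Heisenberg.T) = [1, 1, 1, 2, 2, 4] ∧
      Heisenberg.dims (Heisenberg.bi Heisenberg.O Heisenberg.O) = [1, 1, 1, 2, 2, 3] ∧
      Heisenberg.dims Heisenberg.OO' = [1, 2, 3, 5, 6, 9] ∧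
      Heisenberg.dims Heisenberg.OO'' = [1, 1, 2, 3, 3, 5] ∧
      Heisenberg.dims (Heisenberg.bi Heisenberg.I Heisenberg.V) = [1, 1, 1, 1, 1, 5] ∧
      Heisenberg.dims (Heisenberg.bi Heisenberg.I Heisenberg.T) = [1, 1, 1, 1, 1, 3] ∧
      Heisenberg.dims (Heisenberg.bi Heisenberg.I Heisenberg.O) = [1, 1, 1, 1, 1, 2] ∧
      Heisenberg.dims (Heisenberg.bi Heisenberg.I Heisenberg.I) = [1, 1, 1, 1, 1, 2]) ∧
    -- the second table
    (Heisenberg.dims (Heisenberg.bi Heisenberg.V (Heisenberg.D 4)) = [1, 3, 3, 9, 11, 19] ∧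
      Heisenberg.dims (Heisenberg.bi Heisenberg.V (Heisenberg.D 6)) = [1, 3, 3, 6, 6, 14] ∧
      Heisenberg.dims (Heisenberg.bi Heisenberg.V (Heisenberg.D 8)) = [1, 3, 3, 6, 6, 10] ∧
      Heisenberg.dims (Heisenberg.bi Heisenberg.T (Heisenberg.D 4)) = [1, 1, 1, 3, 3, 7] ∧
      Heisenberg.dims (Heisenberg.bi Heisenberg.T (Heisenberg.D 6)) = [1, 1, 1, 2, 2, 6] ∧
      Heisenberg.dims (Heisenberg.bi Heisenberg.T (Heisenberg.D 8)) = [1, 1, 1, 2, 2, 4] ∧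
      Heisenberg.dims (Heisenberg.bi Heisenberg.O (Heisenberg.D 4)) = [1, 1, 1, 3, 3, 5] ∧
      Heisenberg.dims (Heisenberg.bi Heisenberg.O (Heisenberg.D 6)) = [1, 1, 1, 2, 2, 4] ∧
      Heisenberg.dims (Heisenberg.bi Heisenberg.O (Heisenberg.D 8)) = [1, 1, 1, 2, 2, 3] ∧
      Heisenberg.dims (Heisenberg.bi Heisenberg.I (Heisenberg.D 4)) = [1, 1, 1, 1, 1, 3] ∧
      Heisenberg.dims (Heisenberg.bi Heisenberg.I (Heisenberg.D 6)) = [1, 1, 1, 1, 1, 3] ∧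
      Heisenberg.dims (Heisenberg.bi Heisenberg.I (Heisenberg.D 8)) = [1, 1, 1, 1, 1, 2]) ∧
    -- the two-dimensional spaces
    (Heisenberg.m Heisenberg.OO' 4 = 2 ∧
      Heisenberg.m (Heisenberg.bi Heisenberg.T Heisenberg.T) 6 = 2 ∧
      Heisenberg.m (Heisenberg.bi Heisenberg.O Heisenberg.O) 8 = 2 ∧
      Heisenberg.m (Heisenberg.bi Heisenberg.I Heisenberg.O) 12 = 2 ∧
      Heisenberg.m (Heisenberg.bi Heisenberg.I Heisenberg.I) 12 = 2 ∧
      (∀ n m : ℕ, Even n → Even m → 4 ≤ n → 4 ≤ m →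
        Heisenberg.m (Heisenberg.bi (Heisenberg.D n) (Heisenberg.D m)) 4 = 2) ∧
      (∀ n : ℕ, Even n → 6 ≤ n →
        Heisenberg.m (Heisenberg.bi Heisenberg.O (Heisenberg.D n)) 8 = 2) ∧
      (∀ n : ℕ, Even n → 8 ≤ n →
        Heisenberg.m (Heisenberg.bi Heisenberg.I (Heisenberg.D n)) 12 = 2)) := by
  have hV := fun (l : ℕ) (_ : 1 ≤ l) (h : l ≤ 6) => Heisenberg.finrank_invVec_V l h
  have hT := fun (l : ℕ) (_ : 1 ≤ l) (h : l ≤ 6) => Heisenberg.finrank_invVec_T l h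
  have hO := fun (l : ℕ) (_ : 1 ≤ l) (h : l ≤ 6) => Heisenberg.finrank_invVec_O l h
  have hI := Heisenberg.finrank_invVec_I
  have h4 := fun (l : ℕ) (_ : 1 ≤ l) (h : l ≤ 6) => Heisenberg.finrank_invVec_D_four l h
  have h6 := fun (l : ℕ) (_ : 1 ≤ l) (h : l ≤ 6) => Heisenberg.finrank_invVec_D_six l h
  have h8 := fun (l : ℕ) (_ : 1 ≤ l) (h : l ≤ 6) => Heisenberg.finrank_invVec_D_eight l h
  refine ⟨fun G hG d hd => Heisenberg.invariantForms_eq_bot_of_odd hG hd, ?_, ?_, ?_⟩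
  · exact ⟨(Heisenberg.dims_bi hV hV).trans (by decide),
      (Heisenberg.dims_bi hT hV).trans (by decide),
      (Heisenberg.dims_bi hT hT).trans (by decide),
      (Heisenberg.dims_quaternary fun l _ h => Heisenberg.finrank_invMat_TT' l h).trans (by decide),
      (Heisenberg.dims_bi hO hV).trans (by decide),
      (Heisenberg.dims_bi hO hT).trans (by decide),
      (Heisenberg.dims_bi hO hO).trans (by decide),
      (Heisenberg.dims_quaternary fun l _ h => Heisenberg.finrank_invMat_OO' l h).trans (by decide),
      (Heisenberg.dims_quaternary fun l _ h => Heisenberg.finrank_invMat_OO'' l h).trans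
        (by decide),
      (Heisenberg.dims_bi hI hV).trans (by decide),
      (Heisenberg.dims_bi hI hT).trans (by decide),
      (Heisenberg.dims_bi hI hO).trans (by decide),
      (Heisenberg.dims_bi hI hI).trans (by decide)⟩
  · exact ⟨(Heisenberg.dims_bi hV h4).trans (by decide),
      (Heisenberg.dims_bi hV h6).trans (by decide),
      (Heisenberg.dims_bi hV h8).trans (by decide),
      (Heisenberg.dims_bi hT h4).trans (by decide),
      (Heisenberg.dims_bi hT h6).trans (by decide),
      (Heisenberg.dims_bi hT h8).trans (by decide),
      (Heisenberg.dims_bi hO h4).trans (by decide),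
      (Heisenberg.dims_bi hO h6).trans (by decide),
      (Heisenberg.dims_bi hO h8).trans (by decide),
      (Heisenberg.dims_bi hI h4).trans (by decide),
      (Heisenberg.dims_bi hI h6).trans (by decide),
      (Heisenberg.dims_bi hI h8).trans (by decide)⟩
  · refine ⟨?_, ?_, ?_, ?_, ?_, fun n m hn hm hn4 hm4 => ?_, fun n hn hn6 => ?_, fun n hn hn8 => ?_⟩
    · refine (Heisenberg.m_two_mul _ 2).trans ?_
      simp only [Finset.sum_range_succ, Finset.sum_range_zero,
        Heisenberg.finrank_invMat_OO' (0 + 1) (by norm_num),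
        Heisenberg.finrank_invMat_OO' (1 + 1) (by norm_num)]
      decide
    · exact (Heisenberg.m_bi_two_mul_eq_of_le (e := 3) (fun l h1 h => hT l h1 (by omega))
        (fun l h1 h => hT l h1 (by omega))).trans (by decide)
    · exact (Heisenberg.m_bi_two_mul_eq_of_le (e := 4) (fun l h1 h => hO l h1 (by omega))
        (fun l h1 h => hO l h1 (by omega))).trans (by decide)
    · exact (Heisenberg.m_bi_two_mul_eq_of_le hI hO (e := 6)).trans (by decide)
    · exact (Heisenberg.m_bi_two_mul_eq_of_le hI hI (e := 6)).trans (by decide)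
    -- The bounds on `n` and `m` leave only the weight zero for the dihedral factors.
    · exact (Heisenberg.m_bi_two_mul_eq_of_le (e := 2)
        (fun l _ h => Heisenberg.finrank_invVec_dihedral_of_lt hn (by omega))
        (fun l _ h => Heisenberg.finrank_invVec_dihedral_of_lt hm (by omega))).trans (by decide)
    · exact (Heisenberg.m_bi_two_mul_eq_of_le (e := 4)
        (fun l h1 h => hO l h1 (by omega))
        (fun l _ h => Heisenberg.finrank_invVec_dihedral_of_lt hn (by omega))).trans (by decide)
    · exact (Heisenberg.m_bi_two_mul_eq_of_le (e := 6) hI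
        (fun l _ h => Heisenberg.finrank_invVec_dihedral_of_lt hn (by omega))).trans (by decide)
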